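/- Let $n\ge 0$, let $\Omega\subset\mathbb R^n_x\times\mathbb R^n_\eta$ be an open neighbourhood of $(0,0)$ and let $\phi\in C^\infty(\Omega;\mathbb R)$ satisfy $\phi'(0,0)=0$ and $\det\phi''_{x\eta}(0,0)\neq 0$. Suppose that $$\kappa:(\phi'_\eta(x,\eta),\eta)\mapsto(x,\phi'_x(x,\eta)),\qquad (x,\eta)\in\Omega,$$ defines a smooth diffeomorphism (the canonical transformation of $\phi$) from the open set $\{(\phi'_\eta(x,\eta),\eta):(x,\eta)\in\Omega\}$ onto an open set, that $(0,0)$ is its only fixed point, and that $\det(d\kappa(0,0)-1)\neq0$. Let $b(x,\eta;h)$, $0<h\le1$, be a classical symbol of order $0$ supported in a fixed compact subset of $\Omega$: $b(\cdot;h)$ is smooth and $b\sim\sum_{j\ge0}h^jb_j$, with $b_j$ smooth, in the sense that for every $N$ all $(x,\eta)$-derivatives of $b-\sum_{j<N}h^jb_j$ are $\mathcal O(h^N)$, uniformly in $(x,\eta)$ and $0<h\le 1$. Then for every $h\in(0,1]$ the formula $$Bu(x)=\frac1{(2\pi h)^n}\iint e^{i(\phi(x,\eta)-y\cdot\eta)/h}\,b(x,\eta;h)\,u(y)\,dy\,d\eta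 ,\qquad u\in L^1(\mathbb R^n)\cap L^2(\mathbb R^n),$$ defines a unique bounded operator $B$ on $L^2(\mathbb R^n)$, this operator is of trace class, and $$\operatorname{tr}B=i^{s/2}\,\frac{(b_0(0,0)+\mathcal O(h))\,e^{i\phi(0,0)/h}}{\left|\det\phi''_{\eta x}(0,0)\,\det(d\kappa(0,0)-1)\right|^{1/2}},\qquad 0<h\le 1,$$ where $i^{s/2}=e^{i\pi s/4}$ and $$s=\operatorname{sgn}\begin{pmatrix}\phi''_{xx}&\phi''_{x\eta}-1\\ \phi''_{\eta x}-1&\phi''_{\eta\eta}\end{pmatrix}(0,0)$$ is the signature (number of positive minus number of negative eigenvalues, with multiplicity) of the Hessian of $\phi(x,\eta)-x\cdot\eta$ at $(0,0)$. -/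

import Mathlib

open MeasureTheory Set
open scoped ContDiff InnerProductSpace

/-- The configuration space `ℝⁿ` with its Euclidean structure. -/
abbrev Conf (n : ℕ) : Type := EuclideanSpace ℝ (Fin n)

/-- The phase space `T*ℝⁿ = ℝⁿ × ℝⁿ`. -/
abbrev Phase (n : ℕ) : Type := Conf n × Conf n

/-- The Hilbert space `L²(ℝⁿ; ℂ)`. -/
abbrev L2 (n : ℕ) : Type := Lp ℂ 2 (volume : Measure (Conf n))

/-! ### Trace class operators on a complex Hilbert space -/

section Trace

universe u

variable {H : Type u} [NormedAddCommGroup H] [InnerProductSpace ℂ H]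

/-- Trace class (equivalently, on a Hilbert space, nuclear) operators: absolutely convergent sums
of rank one operators, `T u = ∑ₖ ⟨fₖ, u⟩ gₖ` with `∑ₖ ‖fₖ‖ ‖gₖ‖ < ∞`. -/
def IsTraceClass (T : H →L[ℂ] H) : Prop :=
  ∃ f g : ℕ → H, Summable (fun k => ‖f k‖ * ‖g k‖) ∧
    ∀ u : H, HasSum (fun k => ⟪f k, u⟫_ℂ • g k) (T u)

/-- `T` is of trace class and `tr T = τ`: for every orthonormal basis `e` of `H` the series
`∑ᵢ ⟨eᵢ, T eᵢ⟩` converges (unconditionally) to `τ`. -/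
def HasTrace (T : H →L[ℂ] H) (τ : ℂ) : Prop :=
  IsTraceClass T ∧
    ∀ (ι : Type u) (e : HilbertBasis ι ℂ H), HasSum (fun i => ⟪e i, T (e i)⟫_ℂ) τ

end Trace

/-! ### Derivatives of the phase -/

section Phase

variable {n : ℕ}

/-- The gradient `φ'_x (x, η)` in the first group of variables. -/
noncomputable def gradX (φ : Phase n → ℝ) (p : Phase n) : Conf n :=
  gradient (fun x => φ (x, p.2)) p.1

/-- The gradient `φ'_η (x, η)` in the second group of variables. -/
noncomputable def gradEta (φ : Phase n → ℝ) (p : Phase n) : Conf n :=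
  gradient (fun η => φ (p.1, η)) p.2

/-- The coordinate vector `∂/∂x_i`. -/
noncomputable def vecX (i : Fin n) : Phase n := (EuclideanSpace.single i 1, 0)

/-- The coordinate vector `∂/∂η_i`. -/
noncomputable def vecEta (i : Fin n) : Phase n := (0, EuclideanSpace.single i 1)

/-- The second derivative `∂_v ∂_w φ` at `p`. -/
noncomputable def secondDeriv (φ : Phase n → ℝ) (p v w : Phase n) : ℝ :=
  fderiv ℝ (fun q => fderiv ℝ φ q w) p v

/-- `φ''_{xx}(0,0)`. -/
noncomputable def hessXX (φ : Phase n → ℝ) : Matrix (Fin n) (Fin n) ℝ :=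
  Matrix.of fun i j => secondDeriv φ 0 (vecX i) (vecX j)

/-- `φ''_{xη}(0,0)`: rows indexed by `x`, columns by `η`. -/
noncomputable def hessXEta (φ : Phase n → ℝ) : Matrix (Fin n) (Fin n) ℝ :=
  Matrix.of fun i j => secondDeriv φ 0 (vecX i) (vecEta j)

/-- `φ''_{ηx}(0,0)`: rows indexed by `η`, columns by `x`. -/
noncomputable def hessEtaX (φ : Phase n → ℝ) : Matrix (Fin n) (Fin n) ℝ :=
  Matrix.of fun i j => secondDeriv φ 0 (vecEta i) (vecX j)

/-- `φ''_{ηη}(0,0)`. -/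
noncomputable def hessEtaEta (φ : Phase n → ℝ) : Matrix (Fin n) (Fin n) ℝ :=
  Matrix.of fun i j => secondDeriv φ 0 (vecEta i) (vecEta j)

/-- The Hessian at `(0,0)` of `φ(x,η) - x·η`, as a block matrix. -/
noncomputable def traceHessian (φ : Phase n → ℝ) : Matrix (Fin n ⊕ Fin n) (Fin n ⊕ Fin n) ℝ :=
  Matrix.fromBlocks (hessXX φ) (hessXEta φ - 1) (hessEtaX φ - 1) (hessEtaEta φ)

/-- The signature of a real symmetric matrix: the number of positive minus the number of negative
eigenvalues, counted with multiplicity (as roots of the characteristic polynomial). -/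
noncomputable def matrixSignature {m : Type*} [Fintype m] [DecidableEq m] (A : Matrix m m ℝ) : ℤ :=
  (Multiset.card (A.charpoly.roots.filter (fun t => 0 < t)) : ℤ)
    - (Multiset.card (A.charpoly.roots.filter (fun t => t < 0)) : ℤ)

/-- `κ` is the canonical transformation
`κ : (φ'_η(x,η), η) ↦ (x, φ'_x(x,η))`, `(x,η) ∈ Ω`: a smooth diffeomorphism between the open sets
`κ.source = {(φ'_η(x,η), η) : (x,η) ∈ Ω}` and `κ.target`. -/
structure IsCanonicalMapOf (κ : OpenPartialHomeomorph (Phase n) (Phase n))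
    (φ : Phase n → ℝ) (Ω : Set (Phase n)) : Prop where
  source_eq : κ.source = (fun p : Phase n => ((gradEta φ p, p.2) : Phase n)) '' Ω
  map_eq : ∀ p ∈ Ω, κ (gradEta φ p, p.2) = (p.1, gradX φ p)
  contDiffOn : ContDiffOn ℝ ∞ κ κ.source
  contDiffOn_symm : ContDiffOn ℝ ∞ κ.symm κ.target

/-- `b(·; h)`, `0 < h ≤ 1`, is a classical symbol of order `0` supported in `K`, with expansion
`b ∼ b₀ + h b₁ + h² b₂ + ⋯`: all derivatives of `b - ∑_{j<N} hʲ bⱼ` are `O(h^N)`, uniformly. -/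
structure IsClassicalSymbol (b : ℝ → Phase n → ℂ) (bc : ℕ → Phase n → ℂ)
    (K : Set (Phase n)) : Prop where
  contDiff : ∀ h ∈ Ioc (0 : ℝ) 1, ContDiff ℝ ∞ (b h)
  contDiff_coeff : ∀ j, ContDiff ℝ ∞ (bc j)
  tsupport_subset : ∀ h ∈ Ioc (0 : ℝ) 1, tsupport (b h) ⊆ K
  expansion : ∀ N m : ℕ, ∃ C : ℝ, ∀ h ∈ Ioc (0 : ℝ) 1, ∀ p : Phase n,
    ‖iteratedFDeriv ℝ m
        (fun q => b h q - ∑ j ∈ Finset.range N, (h : ℂ) ^ j * bc j q) p‖ ≤ C * h ^ N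

/-- The oscillatory integral
`(2πh)⁻ⁿ ∬ e^{i(φ(x,η) - y·η)/h} b(x,η) u(y) dy dη`. -/
noncomputable def oscInt (φ : Phase n → ℝ) (b : Phase n → ℂ) (h : ℝ) (u : Conf n → ℂ)
    (x : Conf n) : ℂ :=
  (1 / ((2 * Real.pi * h : ℝ) : ℂ) ^ n) *
    ∫ p : Conf n × Conf n,
      Complex.exp (Complex.I * ((φ (x, p.2) - ⟪p.1, p.2⟫_ℝ : ℝ) : ℂ) / (h : ℂ))
        * b (x, p.2) * u p.1

/-- The bounded operator `B` on `L²(ℝⁿ)` is given by the oscillatory integral, i.e. it agrees with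
it on the dense subspace `L¹ ∩ L²`, on which the integral converges absolutely. -/
def IsOscIntOperator (φ : Phase n → ℝ) (b : Phase n → ℂ) (h : ℝ) (B : L2 n →L[ℂ] L2 n) : Prop :=
  ∀ u : L2 n, Integrable (u : Conf n → ℂ) →
    (B u : Conf n → ℂ) =ᵐ[volume] oscInt φ b h u

end Phase

/-!
The trace of `B` is the integral of its kernel over the diagonal,
`tr B = (2πh)⁻ⁿ ∬ e^{i(φ(x,η) - x·η)/h} b(x,η;h) dx dη`, and the asymptotics are those of stationary
phase for this integral over the phase space `ℝ²ⁿ`.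

*Trace class.* For fixed `h` the function `e^{iφ/h} b` is smooth and compactly supported, hence an
absolutely convergent Fourier series times a cut-off, that is, a series of products of functions of
`x` and of `η` (`exists_separated_expansion`). Each product gives a rank one operator, with norms
summable; this yields existence, the trace class property and the value of the trace
(`existsUnique_and_hasTrace`).

*Stationary phase.* The critical points of `φ(x,η) - x·η` are fixed points of `κ`
(`eq_zero_of_fderiv_sub_inner_eq_zero`), so the origin is the only one. By
`abs_det_traceHessian_eq` the determinant of the Hessian there is
`± det φ''_{ηx} det(dκ - 1) ≠ 0`. The contribution away from the origin is `O(h^∞)` by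
integration by parts (`norm_integral_le_of_no_critical_point`), Morse coordinates
(`exists_morse_coordinates`) make the phase quadratic near the origin, and for a quadratic phase
Parseval's formula with an oscillating Gaussian (`integral_quadratic_phase_mul_eq`) gives the
leading term with an error of relative size `O(h)`. The square roots of the imaginary Gaussian
widths multiply up to `i^{s/2}` (`prod_cpow_half_eigenvalues`).
-/

open scoped Topology FourierTransform

/-! ### Traces of series of rank one operators -/

section TraceLemma

variable {H : Type*} [NormedAddCommGroup H] [InnerProductSpace ℂ H]

/-- Bessel's inequality and the Cauchy–Schwarz inequality. With a bound uniform in the basis, the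
double series computing the trace of `∑ₖ ⟨fₖ, ·⟩ gₖ` is absolutely convergent. -/
theorem HilbertBasis.tsum_norm_inner_mul_inner_le {ι : Type*} (e : HilbertBasis ι ℂ H) (x y : H) :
    Summable (fun i => ‖⟪x, e i⟫_ℂ * ⟪e i, y⟫_ℂ‖) ∧
      ∑' i, ‖⟪x, e i⟫_ℂ * ⟪e i, y⟫_ℂ‖ ≤ ‖x‖ * ‖y‖ := by
  have key : ∀ s : Finset ι, ∑ i ∈ s, ‖⟪x, e i⟫_ℂ * ⟪e i, y⟫_ℂ‖ ≤ ‖x‖ * ‖y‖ := by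
    intro s
    have h1 : ∀ z : H, ∑ i ∈ s, ‖⟪e i, z⟫_ℂ‖ ^ 2 ≤ ‖z‖ ^ 2 := fun z =>
      e.orthonormal.sum_inner_products_le z
    calc ∑ i ∈ s, ‖⟪x, e i⟫_ℂ * ⟪e i, y⟫_ℂ‖
        = ∑ i ∈ s, ‖⟪e i, x⟫_ℂ‖ * ‖⟪e i, y⟫_ℂ‖ := by
          refine Finset.sum_congr rfl fun i _ => ?_
          rw [norm_mul, norm_inner_symm]
      _ ≤ Real.sqrt (∑ i ∈ s, ‖⟪e i, x⟫_ℂ‖ ^ 2) * Real.sqrt (∑ i ∈ s, ‖⟪e i, y⟫_ℂ‖ ^ 2) :=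
          Real.sum_mul_le_sqrt_mul_sqrt _ _ _
      _ ≤ ‖x‖ * ‖y‖ := by
          gcongr
          · exact Real.sqrt_le_iff.2 ⟨norm_nonneg _, h1 x⟩
          · exact Real.sqrt_le_iff.2 ⟨norm_nonneg _, h1 y⟩
  have hs := summable_of_sum_le (fun i => norm_nonneg _) key
  exact ⟨hs, hs.tsum_le_of_sum_le key⟩

/-- The trace of an absolutely convergent series of rank one operators, in any orthonormal
basis, is the sum of the traces of its terms. -/
theorem hasTrace_of_rankOne_series {T : H →L[ℂ] H} {f g : ℕ → H}
    (hs : Summable (fun k => ‖f k‖ * ‖g k‖))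
    (hT : ∀ u : H, HasSum (fun k => ⟪f k, u⟫_ℂ • g k) (T u)) :
    HasTrace T (∑' k, ⟪f k, g k⟫_ℂ) := by
  refine ⟨⟨f, g, hs, hT⟩, fun ι e => ?_⟩
  set F : ℕ × ι → ℂ := fun p => ⟪f p.1, e p.2⟫_ℂ * ⟪e p.2, g p.1⟫_ℂ with hF
  -- absolute convergence allows the sums over the rank one terms and over the basis to be exchanged
  have hsum : Summable F := by
    refine Summable.of_norm ?_
    rw [summable_prod_of_nonneg (fun p => norm_nonneg _)]
    refine ⟨fun k => (e.tsum_norm_inner_mul_inner_le (f k) (g k)).1, ?_⟩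
    exact Summable.of_nonneg_of_le (fun k => tsum_nonneg fun i => norm_nonneg _)
      (fun k => (e.tsum_norm_inner_mul_inner_le (f k) (g k)).2) hs
  have h1 : HasSum F (∑' k, ⟪f k, g k⟫_ℂ) := by
    have := hsum.hasSum
    have h2 := this.prod_fiberwise (fun k => e.hasSum_inner_mul_inner (f k) (g k))
    rwa [h2.tsum_eq]
  have h3 : HasSum (F ∘ (Equiv.prodComm ι ℕ)) (∑' k, ⟪f k, g k⟫_ℂ) :=
    (Equiv.hasSum_iff (Equiv.prodComm ι ℕ)).2 h1
  refine h3.prod_fiberwise fun i => ?_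
  have h4 := (hT (e i)).mapL (innerSL ℂ (e i))
  have h5 : (fun k => innerSL ℂ (e i) (⟪f k, e i⟫_ℂ • g k))
      = fun k => (F ∘ (Equiv.prodComm ι ℕ)) (i, k) := by
    funext k
    simp [hF]
  rw [h5] at h4
  exact h4

end TraceLemma

/-! ### Absolutely convergent Fourier series -/

section FourierSeries

open UnitAddTorus

theorem Summable.pi_prod {ι κ : Type*} [Fintype ι] {f : κ → ℝ} (hf0 : ∀ j, 0 ≤ f j)
    (hf : Summable f) : Summable (fun k : ι → κ => ∏ i, f (k i)) := by
  classical
  refine summable_of_sum_le (c := ∏ _i : ι, ∑' j, f j)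
    (fun k => Finset.prod_nonneg fun i _ => hf0 _) fun s => ?_
  let t : Finset κ := Finset.univ.biUnion fun i : ι => s.image fun k => k i
  have hst : s ⊆ Fintype.piFinset fun _ : ι => t := by
    intro k hk
    rw [Fintype.mem_piFinset]
    intro i
    simp only [t, Finset.mem_biUnion, Finset.mem_univ, true_and, Finset.mem_image]
    exact ⟨i, k, hk, rfl⟩
  calc ∑ k ∈ s, ∏ i, f (k i) ≤ ∑ k ∈ Fintype.piFinset fun _ : ι => t, ∏ i, f (k i) :=
        Finset.sum_le_sum_of_subset_of_nonneg hst
          fun k _ _ => Finset.prod_nonneg fun i _ => hf0 _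
    _ = ∏ _i : ι, ∑ j ∈ t, f j := Finset.sum_prod_piFinset t fun _ => f
    _ ≤ ∏ _i : ι, ∑' j, f j :=
        Finset.prod_le_prod (fun i _ => Finset.sum_nonneg fun j _ => hf0 _)
          fun i _ => hf.sum_le_tsum t fun j _ => hf0 _

/-- A Schwartz function is summable over the integer lattice. -/
theorem SchwartzMap.summable_norm_intLattice {d : Type*} [Fintype d]
    (g : SchwartzMap (EuclideanSpace ℝ d) ℂ) :
    Summable (fun k : d → ℤ => ‖g (WithLp.toLp 2 fun i => (k i : ℝ))‖) := by
  set N := 2 * Fintype.card d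
  set C := 2 ^ N * ((Finset.Iic (N, 0)).sup fun m => SchwartzMap.seminorm ℝ m.1 m.2) g
  have hdec : ∀ x, (1 + ‖x‖) ^ N * ‖g x‖ ≤ C := fun x => by
    have := SchwartzMap.one_add_le_sup_seminorm_apply (𝕜 := ℝ) (m := (N, 0)) le_rfl le_rfl g x
    simpa using this
  have h1 : Summable (fun j : ℤ => (1 + (j : ℝ) ^ 2)⁻¹) := by
    have h := (Real.summable_one_div_int_pow (p := 2)).2 (by norm_num)
    refine (h.add (hasSum_ite_eq (0 : ℤ) (1 : ℝ)).summable).of_nonneg_of_le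
      (fun j => by positivity) fun j => ?_
    by_cases hj : j = 0
    · simp [hj]
    · have : (0 : ℝ) < (j : ℝ) ^ 2 := by positivity
      simp only [hj, if_false, add_zero, one_div]
      exact inv_anti₀ this (by linarith)
  -- `(1 + ‖x‖)^(2d)` dominates the product of the factors `1 + xᵢ²`, whose inverses are summable
  refine ((Summable.pi_prod (ι := d) (fun j => by positivity) h1).mul_left C).of_nonneg_of_le
    (fun k => norm_nonneg _) fun k => ?_
  set x : EuclideanSpace ℝ d := WithLp.toLp 2 fun i => (k i : ℝ)
  have hx : ∏ i, (1 + (k i : ℝ) ^ 2) ≤ (1 + ‖x‖) ^ N := by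
    calc ∏ i, (1 + (k i : ℝ) ^ 2) ≤ ∏ _i : d, (1 + ‖x‖) ^ 2 := by
          refine Finset.prod_le_prod (fun i _ => by positivity) fun i _ => ?_
          have h2 : |(k i : ℝ)| ≤ ‖x‖ := by
            have := PiLp.norm_apply_le x i
            simpa [x] using this
          have h3 : (k i : ℝ) ^ 2 ≤ ‖x‖ ^ 2 := by
            rw [← sq_abs]; gcongr
          nlinarith [norm_nonneg x]
      _ = (1 + ‖x‖) ^ N := by
          rw [Finset.prod_const, ← pow_mul]; rfl
  have hp : 0 < ∏ i, (1 + (k i : ℝ) ^ 2) := Finset.prod_pos fun i _ => by positivity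
  rw [Finset.prod_inv_distrib, ← div_eq_mul_inv, le_div_iff₀ hp]
  calc ‖g x‖ * ∏ i, (1 + (k i : ℝ) ^ 2) ≤ ‖g x‖ * (1 + ‖x‖) ^ N := by gcongr
    _ ≤ C := by rw [mul_comm]; exact hdec x

theorem UnitAddTorus.mFourier_coe {d : Type*} [Fintype d] (k : d → ℤ) (x : d → ℝ) :
    mFourier k (fun i => (x i : UnitAddCircle))
      = Complex.exp (2 * Real.pi * Complex.I * ∑ i, (k i : ℂ) * x i) := by
  have : mFourier k (fun i => (x i : UnitAddCircle)) = ∏ i, fourier (k i) (x i : UnitAddCircle) :=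
    rfl
  rw [this, Finset.mul_sum, Complex.exp_sum]
  refine Finset.prod_congr rfl fun i _ => ?_
  rw [fourier_coe_apply]
  congr 1
  push_cast
  ring

/-- The periodization of a continuous function supported in the cube `|xᵢ| ≤ 1/4`, as a continuous
function on the torus. It is defined through the representatives in `(-1/2, 1/2]`, which jump where
`f` vanishes. -/
theorem UnitAddTorus.exists_continuousMap_eq {d : Type*} [Fintype d] (f : (d → ℝ) → ℂ)
    (hf : Continuous f) (hsupp : ∀ x, f x ≠ 0 → ∀ i, |x i| ≤ 1 / 4) :
    ∃ F : C(UnitAddTorus d, ℂ), ∀ x : d → ℝ, (∀ i, x i ∈ Ioc (-(1 / 2) : ℝ) (-(1 / 2) + 1)) →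
      F (fun i => (x i : UnitAddCircle)) = f x := by
  set a : ℝ := -(1 / 2) with ha
  let rep : UnitAddTorus d → d → ℝ := fun θ i => (AddCircle.equivIoc 1 a (θ i)).1
  have hcont : Continuous (f ∘ rep) := by
    rw [continuous_iff_continuousAt]
    intro θ
    by_cases hθ : ∀ i, θ i ≠ (a : UnitAddCircle)
    · refine hf.continuousAt.comp (continuousAt_pi.2 fun i => ?_)
      have h1 : ContinuousAt (fun y : UnitAddCircle => ((AddCircle.equivIoc 1 a y).1 : ℝ)) (θ i) :=
        continuous_subtype_val.continuousAt.comp (AddCircle.continuousAt_equivIoc (1 : ℝ) a (hθ i))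
      exact ContinuousAt.comp (f := fun θ : UnitAddTorus d => θ i) h1
        (continuous_apply i).continuousAt
    · push Not at hθ
      obtain ⟨i, hi⟩ := hθ
      -- near the boundary of the cube the periodization vanishes
      set S : Set UnitAddCircle := (fun y : ℝ => (y : UnitAddCircle)) '' Icc (-(1 / 4)) (1 / 4)
      have hS : IsClosed S := (isCompact_Icc.image (AddCircle.continuous_mk' 1)).isClosed
      have hiS : θ i ∉ S := by
        rintro ⟨y, hy, hyi⟩
        have hy1 : -(1 / 4) ≤ y := hy.1
        have hy2 : y ≤ 1 / 4 := hy.2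
        have h1 : ((a + 1 : ℝ) : UnitAddCircle) = (y : UnitAddCircle) := by
          rw [AddCircle.coe_add_period, ← hi]; exact hyi.symm
        have h2 : AddCircle.equivIoc 1 a ((a + 1 : ℝ) : UnitAddCircle) = a + 1 :=
          AddCircle.equivIoc_coe_of_mem ⟨by linarith, le_rfl⟩
        have h3 : AddCircle.equivIoc 1 a (y : UnitAddCircle) = y :=
          AddCircle.equivIoc_coe_of_mem ⟨by rw [ha]; linarith, by rw [ha]; linarith⟩
        rw [h1, h3] at h2
        rw [ha] at h2
        linarith
      have hev : ∀ᶠ θ' in nhds θ, θ' i ∉ S :=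
        (continuous_apply i).continuousAt.eventually (hS.isOpen_compl.mem_nhds hiS)
      have hzero : ∀ᶠ θ' in nhds θ, (f ∘ rep) θ' = 0 := by
        filter_upwards [hev] with θ' hθ'
        by_contra hne
        refine hθ' ⟨rep θ' i, abs_le.1 (hsupp _ hne i), ?_⟩
        exact AddCircle.coe_equivIoc
      exact continuousAt_const.congr (hzero.mono fun _ h => h.symm)
  refine ⟨⟨_, hcont⟩, fun x hx => ?_⟩
  change f _ = f x
  congr 1
  funext i
  exact AddCircle.equivIoc_coe_of_mem (hx i)

/-- A smooth function supported in the cube `|xᵢ| ≤ 1/4` is the sum of an absolutely convergent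
Fourier series in the open cube `|xᵢ| < 1/2`. -/
theorem exists_fourierSeries_of_unitCube {d : Type*} [Fintype d] (f : EuclideanSpace ℝ d → ℂ)
    (hf : ContDiff ℝ ∞ f) (hsupp : ∀ x, f x ≠ 0 → ∀ i, |x i| ≤ 1 / 4) :
    ∃ c : (d → ℤ) → ℂ, Summable (fun k => ‖c k‖) ∧ ∀ x : EuclideanSpace ℝ d,
      (∀ i, |x i| < 1 / 2) →
      HasSum (fun k => c k * Complex.exp (2 * Real.pi * Complex.I * ∑ i, (k i : ℂ) * x i))
        (f x) := by
  have hcs : HasCompactSupport f := by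
    have hK : IsCompact (WithLp.toLp 2 '' (Set.univ.pi fun _ : d => Icc (-(1 / 4) : ℝ) (1 / 4))) :=
      (isCompact_univ_pi fun _ => isCompact_Icc).image (PiLp.continuous_toLp 2 _)
    refine HasCompactSupport.of_support_subset_isCompact hK fun x hx => ?_
    exact ⟨x.ofLp, fun i _ => abs_le.1 (hsupp x hx i), rfl⟩
  let f' : SchwartzMap (EuclideanSpace ℝ d) ℂ := hcs.toSchwartzMap hf
  have hf' : (f' : EuclideanSpace ℝ d → ℂ) = f := rfl
  obtain ⟨F, hF⟩ := UnitAddTorus.exists_continuousMap_eq (fun x : d → ℝ => f (WithLp.toLp 2 x))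
    (hf.continuous.comp (PiLp.continuous_toLp 2 _)) (fun x hx i => hsupp _ hx i)
  -- the Fourier coefficients are the values of the Fourier transform at the lattice points
  have hcoef : ∀ k : d → ℤ, mFourierCoeff F k = (𝓕 f') (WithLp.toLp 2 fun i => (k i : ℝ)) := by
    intro k
    rw [SchwartzMap.fourier_coe, Real.fourier_eq, mFourierCoeff_eq_integral _ _ (fun _ => -(1 / 2)),
      hf', ← (PiLp.volume_preserving_toLp d).integral_comp
        (MeasurableEquiv.toLp 2 (d → ℝ)).measurableEmbedding]
    rw [← integral_indicator (by measurability)]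
    refine integral_congr_ae (Filter.Eventually.of_forall fun x => ?_)
    have hexp : mFourier (-k) (fun i => (x i : UnitAddCircle))
        = (Real.fourierChar (-⟪WithLp.toLp 2 x, WithLp.toLp 2 fun i => (k i : ℝ)⟫_ℝ) : ℂ) := by
      rw [UnitAddTorus.mFourier_coe, Real.fourierChar_apply, PiLp.inner_apply]
      congr 1
      push_cast
      simp only [Pi.neg_apply, RCLike.inner_apply, conj_trivial, Complex.ofReal_mul,
        Complex.ofReal_intCast, Int.cast_neg, neg_mul, Finset.sum_neg_distrib]
      ring
    by_cases hx : x ∈ {x : d → ℝ | ∀ i, x i ∈ Ioc (-(1 / 2) : ℝ) (-(1 / 2) + 1)}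
    · simp only [Set.indicator_of_mem hx, hF x hx, hexp]
      rfl
    · rw [Set.indicator_of_notMem hx]
      have h0 : f (WithLp.toLp 2 x) = 0 := by
        by_contra hne
        refine hx fun i => ?_
        have := abs_le.1 (hsupp _ hne i)
        simp only at this
        constructor <;> linarith [this.1, this.2]
      simp [h0]
  have hsum : Summable (fun k => ‖mFourierCoeff F k‖) := by
    simp_rw [hcoef]
    exact SchwartzMap.summable_norm_intLattice (𝓕 f')
  refine ⟨mFourierCoeff F, hsum, fun x hx => ?_⟩
  have h := hasSum_mFourier_series_apply_of_summable hsum.of_norm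
    (fun i => (x i : UnitAddCircle))
  rw [hF x.ofLp fun i => ⟨by linarith [(abs_lt.1 (hx i)).1], by linarith [(abs_lt.1 (hx i)).2]⟩] at h
  simp_rw [UnitAddTorus.mFourier_coe] at h
  exact h

/-- Fourier expansion of a smooth function supported in the cube `|xᵢ| ≤ R`, valid in a cube
of twice the size. -/
theorem exists_fourierSeries {d : Type*} [Fintype d] (f : EuclideanSpace ℝ d → ℂ)
    (hf : ContDiff ℝ ∞ f) {R : ℝ} (hR : 0 < R) (hsupp : ∀ x, f x ≠ 0 → ∀ i, |x i| ≤ R) :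
    ∃ c : (d → ℤ) → ℂ, Summable (fun k => ‖c k‖) ∧ ∀ x : EuclideanSpace ℝ d,
      (∀ i, |x i| < 2 * R) →
      HasSum (fun k => c k *
        Complex.exp (2 * Real.pi * Complex.I * ∑ i, (k i : ℂ) * (x i / (4 * R) : ℝ))) (f x) := by
  have h4R : (0 : ℝ) < 4 * R := by positivity
  obtain ⟨c, hc, hsum⟩ := exists_fourierSeries_of_unitCube (fun x => f ((4 * R) • x))
    (hf.comp (contDiff_const_smul _)) (fun x hx i => by
      have := hsupp _ hx i
      simp only [PiLp.smul_apply, smul_eq_mul, abs_mul, abs_of_pos h4R] at this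
      have h2 : R * (4 * |x i|) ≤ R * 1 := by linarith
      have := le_of_mul_le_mul_left h2 hR
      linarith)
  refine ⟨c, hc, fun x hx => ?_⟩
  have := hsum ((4 * R)⁻¹ • x) fun i => by
    simp only [PiLp.smul_apply, smul_eq_mul, abs_mul, abs_of_pos (inv_pos.2 h4R)]
    rw [inv_mul_lt_iff₀ h4R]
    linarith [hx i]
  simp only [smul_inv_smul₀ h4R.ne', PiLp.smul_apply, smul_eq_mul] at this
  simpa only [div_eq_inv_mul] using this

end FourierSeries

/-! ### Separation of variables on phase space -/

section PhaseCoordinates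

/-- The linear identification of `ℝ^{2n}`, with coordinates indexed by a sum type, with the phase
space. -/
noncomputable def phaseEquiv (n : ℕ) : EuclideanSpace ℝ (Fin n ⊕ Fin n) ≃L[ℝ] Phase n :=
  (PiLp.sumPiLpEquivProdLpPiLp (𝕜 := ℝ) 2
    (fun _ : Fin n ⊕ Fin n => ℝ)).toContinuousLinearEquiv.trans
    (WithLp.prodContinuousLinearEquiv 2 ℝ _ _)

variable {n : ℕ}

@[simp]
theorem phaseEquiv_apply_fst (v : EuclideanSpace ℝ (Fin n ⊕ Fin n)) (i : Fin n) :
    (phaseEquiv n v).1 i = v (Sum.inl i) := rfl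

@[simp]
theorem phaseEquiv_apply_snd (v : EuclideanSpace ℝ (Fin n ⊕ Fin n)) (i : Fin n) :
    (phaseEquiv n v).2 i = v (Sum.inr i) := rfl

@[simp]
theorem phaseEquiv_symm_apply_inl (p : Phase n) (i : Fin n) :
    (phaseEquiv n).symm p (Sum.inl i) = p.1 i := rfl

@[simp]
theorem phaseEquiv_symm_apply_inr (p : Phase n) (i : Fin n) :
    (phaseEquiv n).symm p (Sum.inr i) = p.2 i := rfl

theorem measurePreserving_phaseEquiv : MeasurePreserving (phaseEquiv n) :=
  (WithLp.volume_preserving_ofLp (Conf n) (Conf n)).comp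
    (PiLp.sumPiLpEquivProdLpPiLp (𝕜 := ℝ) 2 (fun _ : Fin n ⊕ Fin n => ℝ)).measurePreserving

theorem integral_comp_phaseEquiv {G : Type*} [NormedAddCommGroup G] [NormedSpace ℝ G]
    (f : Phase n → G) : ∫ v, f (phaseEquiv n v) = ∫ p, f p :=
  measurePreserving_phaseEquiv.integral_comp
    (phaseEquiv n).toHomeomorph.measurableEmbedding f

/-- A smooth compactly supported function on phase space is an absolutely convergent series of
products of functions of `x` and functions of `η`: a Fourier series multiplied by a cut-off, equal
to `1` on the support of `a` and supported in the larger cube where the series converges to `a`. -/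
theorem exists_separated_expansion (a : Phase n → ℂ) (ha : ContDiff ℝ ∞ a)
    (hac : HasCompactSupport a) :
    ∃ (χ : Conf n → ℂ) (c : ℕ → ℂ) (α β : ℕ → Conf n), ContDiff ℝ ∞ χ ∧ HasCompactSupport χ ∧
      Summable (fun k => ‖c k‖) ∧ ∀ x η : Conf n, HasSum (fun k =>
        c k * (Complex.exp (Complex.I * (⟪α k, x⟫_ℝ : ℝ)) * χ x) *
          (Complex.exp (Complex.I * (⟪β k, η⟫_ℝ : ℝ)) * χ η)) (a (x, η)) := by
  obtain ⟨R, hR, hsupp⟩ : ∃ R : ℝ, 0 < R ∧ ∀ p, a p ≠ 0 → ‖p‖ ≤ R := by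
    obtain ⟨R, hR, h⟩ := hac.isCompact.isBounded.exists_pos_norm_le
    exact ⟨R, hR, fun p hp => h p (subset_tsupport a hp)⟩
  let χ₀ : ContDiffBump (0 : Conf n) := ⟨R, 3 / 2 * R, hR, by linarith⟩
  let χ : Conf n → ℂ := fun x => (χ₀ x : ℂ)
  have hχ1 : ∀ x : Conf n, ‖x‖ ≤ R → χ x = 1 := fun x hx => by
    simp only [χ, χ₀.one_of_mem_closedBall (by simpa using hx), Complex.ofReal_one]
  have hχ0 : ∀ x : Conf n, χ x ≠ 0 → ∀ i, |x i| < 2 * R := fun x hx i => by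
    have h1 : ‖x‖ < 3 / 2 * R := by
      by_contra hcon
      exact hx (by simp only [χ, χ₀.zero_of_le_dist (x := x) (by simpa using hcon),
        Complex.ofReal_zero])
    have h2 : |x i| ≤ ‖x‖ := by simpa using PiLp.norm_apply_le x i
    linarith
  obtain ⟨c, hc, hsum⟩ := exists_fourierSeries (fun v => a (phaseEquiv n v))
    (ha.comp (phaseEquiv n).contDiff) hR (fun v hv i => by
      have h1 := hsupp _ hv
      rcases i with i | i
      · have h2 := PiLp.norm_apply_le (phaseEquiv n v).1 i
        have h3 := (norm_fst_le (phaseEquiv n v)).trans h1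
        simpa using h2.trans h3
      · have h2 := PiLp.norm_apply_le (phaseEquiv n v).2 i
        have h3 := (norm_snd_le (phaseEquiv n v)).trans h1
        simpa using h2.trans h3)
  -- the frequencies are enumerated by the natural numbers
  obtain ⟨e, he⟩ := exists_injective_nat (Fin n ⊕ Fin n → ℤ)
  let α : (Fin n ⊕ Fin n → ℤ) → Conf n := fun k =>
    WithLp.toLp 2 fun i => 2 * Real.pi / (4 * R) * (k (Sum.inl i) : ℝ)
  let β : (Fin n ⊕ Fin n → ℤ) → Conf n := fun k =>
    WithLp.toLp 2 fun i => 2 * Real.pi / (4 * R) * (k (Sum.inr i) : ℝ)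
  refine ⟨χ, Function.extend e c 0, Function.extend e α 0, Function.extend e β 0,
    Complex.ofRealCLM.contDiff.comp χ₀.contDiff,
    χ₀.hasCompactSupport.comp_left (g := fun t : ℝ => (t : ℂ)) Complex.ofReal_zero, ?_, ?_⟩
  · have : (fun k => ‖Function.extend e c 0 k‖) = Function.extend e (fun k => ‖c k‖) 0 := by
      funext k
      by_cases hk : ∃ j, e j = k
      · obtain ⟨j, rfl⟩ := hk
        simp [he.extend_apply]
      · simp [Function.extend_apply' _ _ _ hk]
    rw [this]
    exact (summable_extend_zero he).2 hc
  · intro x η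
    have key : HasSum (fun k => c k * (Complex.exp (Complex.I * (⟪α k, x⟫_ℝ : ℝ)) * χ x) *
          (Complex.exp (Complex.I * (⟪β k, η⟫_ℝ : ℝ)) * χ η)) (a (x, η)) := by
      by_cases hz : χ x * χ η = 0
      · have h1 : a (x, η) = 0 := by
          by_contra hne
          have h2 := hsupp _ hne
          rw [hχ1 x ((norm_fst_le (x, η)).trans h2), hχ1 η ((norm_snd_le (x, η)).trans h2)] at hz
          simp at hz
        rw [h1]
        refine (hasSum_zero (α := ℂ) (β := Fin n ⊕ Fin n → ℤ)).congr_fun ?_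
        intro k
        linear_combination (c k * Complex.exp (Complex.I * (⟪α k, x⟫_ℝ : ℝ)) *
          Complex.exp (Complex.I * (⟪β k, η⟫_ℝ : ℝ))) * hz
      · have hx := hχ0 x (left_ne_zero_of_mul hz)
        have hη := hχ0 η (right_ne_zero_of_mul hz)
        have h1 := (hsum ((phaseEquiv n).symm (x, η)) (by
          rintro (i | i)
          · exact hx i
          · exact hη i)).mul_right (χ x * χ η)
        have h2 : a (x, η) * (χ x * χ η) = a (x, η) := by
          by_cases h0 : a (x, η) = 0
          · simp [h0]
          · have h2 := hsupp _ h0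
            rw [hχ1 x ((norm_fst_le (x, η)).trans h2), hχ1 η ((norm_snd_le (x, η)).trans h2)]
            simp
        simp only [ContinuousLinearEquiv.apply_symm_apply, h2] at h1
        refine h1.congr_fun fun k => ?_
        rw [show c k * (Complex.exp (Complex.I * (⟪α k, x⟫_ℝ : ℝ)) * χ x) *
          (Complex.exp (Complex.I * (⟪β k, η⟫_ℝ : ℝ)) * χ η) = c k *
          (Complex.exp (Complex.I * (⟪α k, x⟫_ℝ : ℝ)) * Complex.exp (Complex.I * (⟪β k, η⟫_ℝ : ℝ)))
          * (χ x * χ η) by ring, ← Complex.exp_add]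
        congr 3
        rw [Fintype.sum_sum_type, PiLp.inner_apply, PiLp.inner_apply, mul_add]
        simp only [phaseEquiv_symm_apply_inl, phaseEquiv_symm_apply_inr, RCLike.inner_apply,
          conj_trivial, α, β, Complex.ofReal_sum, Finset.mul_sum]
        congr 1 <;>
        · refine Finset.sum_congr rfl fun i _ => ?_
          push_cast
          ring
    have h3 := (hasSum_extend_zero he).2 key
    refine h3.congr_fun fun k => ?_
    by_cases hk : ∃ j, e j = k
    · obtain ⟨j, rfl⟩ := hk
      simp [he.extend_apply]
    · simp [Function.extend_apply' _ _ _ hk]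

end PhaseCoordinates

/-! ### Oscillatory integral operators are of trace class -/

section Operator

/-- An absolutely convergent series of rank one operators converges to a bounded operator. -/
theorem exists_operator_of_rankOne_series {H : Type*} [NormedAddCommGroup H]
    [InnerProductSpace ℂ H] [CompleteSpace H] {f g : ℕ → H}
    (hs : Summable (fun k => ‖f k‖ * ‖g k‖)) :
    ∃ T : H →L[ℂ] H, ∀ u : H, HasSum (fun k => ⟪f k, u⟫_ℂ • g k) (T u) := by
  have h1 : Summable (fun k => InnerProductSpace.rankOne ℂ (g k) (f k)) := by
    refine Summable.of_norm ?_
    refine hs.congr fun k => ?_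
    rw [InnerProductSpace.norm_rankOne, mul_comm]
  refine ⟨∑' k, InnerProductSpace.rankOne ℂ (g k) (f k), fun u => ?_⟩
  have h2 := (ContinuousLinearMap.apply ℂ H u).hasSum h1.hasSum
  simpa using h2

/-- If a series converges in `L²` and also pointwise almost everywhere, the sums agree. -/
theorem MeasureTheory.Lp.ae_eq_of_hasSum {X : Type*} [MeasurableSpace X] {μ : Measure X}
    {g : ℕ → Lp ℂ 2 μ} {G : Lp ℂ 2 μ} (hG : HasSum g G) {F : X → ℂ}
    (hF : ∀ᵐ x ∂μ, HasSum (fun k => g k x) (F x)) : (G : X → ℂ) =ᵐ[μ] F := by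
  have h1 := tendstoInMeasure_of_tendsto_Lp hG.tendsto_sum_nat
  obtain ⟨ns, hns, hlim⟩ := h1.exists_seq_tendsto_ae
  have h2 : ∀ᵐ x ∂μ, ∀ N, (∑ k ∈ Finset.range N, g k : Lp ℂ 2 μ) x
      = ∑ k ∈ Finset.range N, g k x := by
    rw [ae_all_iff]
    intro N
    filter_upwards [Lp.coeFn_finsetSum (Finset.range N) g] with x hx
    rw [hx, Finset.sum_apply]
  filter_upwards [hF, hlim, h2] with x hx hl hs
  simp only [hs] at hl
  exact tendsto_nhds_unique hl (hx.tendsto_sum_nat.comp hns.tendsto_atTop)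

variable {n : ℕ}

/-- The function `y ↦ (2πh)⁻ⁿ ∫ e^{i(β - y/h)·η} χ(η) dη`: the semiclassical Fourier transform of the
modulated cut-off `e^{iβ·η} χ(η)`. If `e^{iφ/h} b` is a product `g(x) e^{iβ·η} χ(η)`, then the
oscillatory integral is the rank one operator with kernel `g(x)` times this function of `y`. -/
noncomputable def modulatedKernel (h : ℝ) (χ : Conf n → ℂ) (β y : Conf n) : ℂ :=
  (1 / ((2 * Real.pi * h : ℝ) : ℂ) ^ n) * ∫ η : Conf n,
    Complex.exp (Complex.I * ((-⟪y, η⟫_ℝ : ℝ) : ℂ) / h) *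
      (Complex.exp (Complex.I * (⟪β, η⟫_ℝ : ℝ)) * χ η)

/-- Modulating the cut-off by `β` translates the kernel by `h β`. -/
theorem modulatedKernel_eq_translate {h : ℝ} (hh : 0 < h) (χ : Conf n → ℂ) (β y : Conf n) :
    modulatedKernel h χ β y = modulatedKernel h χ 0 (y - h • β) := by
  unfold modulatedKernel
  congr 1
  refine integral_congr_ae (Filter.Eventually.of_forall fun η => ?_)
  have hh' : (h : ℂ) ≠ 0 := by exact_mod_cast hh.ne'
  simp only [inner_zero_left, Complex.ofReal_zero, mul_zero, Complex.exp_zero, one_mul, ← mul_assoc,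
    ← Complex.exp_add]
  congr 2
  rw [inner_sub_left, inner_smul_left]
  push_cast
  simp only [conj_trivial]
  field_simp
  ring

theorem exists_schwartzMap_eq_modulatedKernel {h : ℝ} (hh : 0 < h) {χ : Conf n → ℂ}
    (hχ : ContDiff ℝ ∞ χ) (hχc : HasCompactSupport χ) :
    ∃ G : SchwartzMap (Conf n) ℂ, ∀ y, modulatedKernel h χ 0 y = G y := by
  have h2 : (2 * Real.pi * h)⁻¹ ≠ 0 := by positivity
  let G₀ : SchwartzMap (Conf n) ℂ := 𝓕 (hχc.toSchwartzMap hχ)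
  let e : Conf n ≃L[ℝ] Conf n := ContinuousLinearEquiv.smulLeft (Units.mk0 _ h2)
  refine ⟨(1 / ((2 * Real.pi * h : ℝ) : ℂ) ^ n) • SchwartzMap.compCLMOfContinuousLinearEquiv ℂ e G₀,
    fun y => ?_⟩
  have : SchwartzMap.compCLMOfContinuousLinearEquiv ℂ e G₀ y = G₀ ((2 * Real.pi * h)⁻¹ • y) := rfl
  rw [smul_apply, this, smul_eq_mul, SchwartzMap.fourier_coe, Real.fourier_eq]
  unfold modulatedKernel
  congr 1
  refine integral_congr_ae (Filter.Eventually.of_forall fun η => ?_)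
  have hpi : (Real.pi : ℂ) ≠ 0 := by exact_mod_cast Real.pi_ne_zero
  have hh' : (h : ℂ) ≠ 0 := by exact_mod_cast hh.ne'
  change _ = ((Real.fourierChar (-⟪η, (2 * Real.pi * h)⁻¹ • y⟫_ℝ) : Circle) : ℂ) * χ η
  rw [Real.fourierChar_apply, inner_smul_right, ← real_inner_comm η y]
  simp only [inner_zero_left, Complex.ofReal_zero, mul_zero, Complex.exp_zero, one_mul]
  congr 2
  push_cast
  field_simp

/-- The `L²` norm of the kernel does not depend on the modulation, so that the summability of the
coefficients of a separated expansion is all that convergence in trace norm needs. -/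
theorem memLp_modulatedKernel {h : ℝ} (hh : 0 < h) {χ : Conf n → ℂ}
    (hχ : ContDiff ℝ ∞ χ) (hχc : HasCompactSupport χ) (β : Conf n) :
    MemLp (modulatedKernel h χ β) 2 volume ∧
      eLpNorm (modulatedKernel h χ β) 2 volume = eLpNorm (modulatedKernel h χ 0) 2 volume := by
  obtain ⟨G, hG⟩ := exists_schwartzMap_eq_modulatedKernel hh hχ hχc
  have h0 : modulatedKernel h χ 0 = G := funext hG
  have hβ : modulatedKernel h χ β = G ∘ fun y => y - h • β := by
    funext y
    rw [modulatedKernel_eq_translate hh, hG]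
    rfl
  have hmp := measurePreserving_sub_right (volume : Measure (Conf n)) (h • β)
  rw [h0, hβ]
  exact ⟨(G.memLp 2 volume).comp_measurePreserving hmp,
    eLpNorm_comp_measurePreserving (G.memLp 2 volume).1 hmp⟩

theorem norm_cexp_I_mul_div (t h : ℝ) :
    ‖Complex.exp (Complex.I * (t : ℂ) / (h : ℂ))‖ = 1 := by
  rw [show Complex.I * (t : ℂ) / (h : ℂ) = ((t / h : ℝ) : ℂ) * Complex.I by push_cast; ring,
    Complex.norm_exp_ofReal_mul_I]

theorem norm_cexp_I_mul (t : ℝ) : ‖Complex.exp (Complex.I * (t : ℂ))‖ = 1 := by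
  rw [mul_comm, Complex.norm_exp_ofReal_mul_I]

theorem integrable_oscillating_prod {h : ℝ} {χ : Conf n → ℂ} (hχ : Continuous χ)
    (hχc : HasCompactSupport χ) (β : Conf n) {w : Conf n → ℂ} (hw : Integrable w) :
    Integrable (fun p : Conf n × Conf n =>
      Complex.exp (Complex.I * ((-⟪p.1, p.2⟫_ℝ : ℝ) : ℂ) / h) *
        (w p.1 * (Complex.exp (Complex.I * (⟪β, p.2⟫_ℝ : ℝ)) * χ p.2))) := by
  have h1 : Integrable (fun p : Conf n × Conf n => w p.1 * χ p.2) :=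
    hw.mul_prod (hχ.integrable_of_hasCompactSupport hχc)
  refine (h1.bdd_mul (c := 1) (f := fun p : Conf n × Conf n =>
    Complex.exp (Complex.I * ((-⟪p.1, p.2⟫_ℝ : ℝ) : ℂ) / h) *
      Complex.exp (Complex.I * (⟪β, p.2⟫_ℝ : ℝ))) ?_ ?_).congr ?_
  · exact Continuous.aestronglyMeasurable (by fun_prop)
  · refine Filter.Eventually.of_forall fun p => ?_
    rw [norm_mul, norm_cexp_I_mul, norm_cexp_I_mul_div, one_mul]
  · refine Filter.Eventually.of_forall fun p => ?_
    ring

theorem integral_mul_modulatedKernel {h : ℝ} {χ : Conf n → ℂ}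
    (hχ : Continuous χ) (hχc : HasCompactSupport χ) (β : Conf n) {w : Conf n → ℂ}
    (hw : Integrable w) :
    (1 / ((2 * Real.pi * h : ℝ) : ℂ) ^ n) * ∫ p : Conf n × Conf n,
      Complex.exp (Complex.I * ((-⟪p.1, p.2⟫_ℝ : ℝ) : ℂ) / h) *
        (w p.1 * (Complex.exp (Complex.I * (⟪β, p.2⟫_ℝ : ℝ)) * χ p.2))
      = ∫ y, modulatedKernel h χ β y * w y := by
  rw [Measure.volume_eq_prod, integral_prod _ (integrable_oscillating_prod hχ hχc β hw),
    ← integral_const_mul]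
  refine integral_congr_ae (Filter.Eventually.of_forall fun y => ?_)
  simp only [modulatedKernel]
  rw [mul_assoc (1 / ((2 * Real.pi * h : ℝ) : ℂ) ^ n), ← integral_mul_const]
  congr 1
  refine integral_congr_ae (Filter.Eventually.of_forall fun η => ?_)
  ring

/-- Termwise integration of a separated expansion against the kernel `e^{-iy·η/h}`. -/
theorem hasSum_integral_mul_modulatedKernel {h : ℝ} {χ : Conf n → ℂ}
    (hχ : Continuous χ) (hχc : HasCompactSupport χ) (β : ℕ → Conf n) {w : ℕ → Conf n → ℂ}
    (hw : ∀ k, Integrable (w k)) (hws : Summable (fun k => ∫ y, ‖w k y‖)) {A : Phase n → ℂ}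
    (hA : ∀ p : Phase n, HasSum (fun k =>
      w k p.1 * (Complex.exp (Complex.I * (⟪β k, p.2⟫_ℝ : ℝ)) * χ p.2)) (A p)) :
    HasSum (fun k => ∫ y, modulatedKernel h χ (β k) y * w k y)
      ((1 / ((2 * Real.pi * h : ℝ) : ℂ) ^ n) * ∫ p : Conf n × Conf n,
        Complex.exp (Complex.I * ((-⟪p.1, p.2⟫_ℝ : ℝ) : ℂ) / h) * A p) := by
  have h1 := hasSum_integral_of_summable_integral_norm
    (fun k => integrable_oscillating_prod (h := h) hχ hχc (β k) (hw k)) (by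
      refine (hws.mul_right (∫ η, ‖χ η‖)).congr fun k => ?_
      rw [← integral_prod_mul, ← Measure.volume_eq_prod]
      refine integral_congr_ae (Filter.Eventually.of_forall fun p => ?_)
      simp only [norm_mul, norm_cexp_I_mul, norm_cexp_I_mul_div, one_mul])
  have h2 := h1.mul_left (1 / ((2 * Real.pi * h : ℝ) : ℂ) ^ n)
  simp only [integral_mul_modulatedKernel hχ hχc _ (hw _)] at h2
  simp only [((hA _).mul_left _).tsum_eq] at h2
  exact h2

/-- Uniqueness holds because the Schwartz functions are dense in `L²` and integrable. -/
theorem IsOscIntOperator.unique {φ : Phase n → ℝ} {b : Phase n → ℂ} {h : ℝ}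
    {B B' : L2 n →L[ℂ] L2 n} (hB : IsOscIntOperator φ b h B) (hB' : IsOscIntOperator φ b h B') :
    B = B' := by
  refine ContinuousLinearMap.ext fun u => ?_
  refine (SchwartzMap.denseRange_toLpCLM (E := Conf n) (F := ℂ) (p := 2) (μ := volume)
    (by norm_num)).induction_on (p := fun u => B u = B' u) u
    (isClosed_eq B.continuous B'.continuous) fun f => ?_
  have hf : Integrable (SchwartzMap.toLpCLM ℝ ℂ 2 volume f : Conf n → ℂ) :=
    f.integrable.congr (f.coeFn_toLp 2 volume).symm
  exact Lp.ext ((hB _ hf).trans (hB' _ hf).symm)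

/-- The oscillatory integral defines a unique bounded operator, which is of trace class, and its
trace is the integral of its kernel over the diagonal. The separated expansion of `e^{iφ/h} b`
writes the operator as an absolutely convergent series of rank one operators; termwise, both claims
are Fubini's theorem. -/
theorem existsUnique_and_hasTrace {φ : Phase n → ℝ} {b : Phase n → ℂ} {h : ℝ} (hh : 0 < h)
    (hsm : ContDiff ℝ ∞ fun p => Complex.exp (Complex.I * (φ p : ℂ) / h) * b p)
    (hbc : HasCompactSupport b) :
    (∃! B : L2 n →L[ℂ] L2 n, IsOscIntOperator φ b h B) ∧
    ∀ B : L2 n →L[ℂ] L2 n, IsOscIntOperator φ b h B →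
      HasTrace B ((1 / ((2 * Real.pi * h : ℝ) : ℂ) ^ n) * ∫ p : Phase n,
        Complex.exp (Complex.I * ((φ p - ⟪p.1, p.2⟫_ℝ : ℝ) : ℂ) / (h : ℂ)) * b p) := by
  obtain ⟨χ, c, α, β, hχ, hχc, hc, hsum⟩ := exists_separated_expansion _ hsm hbc.mul_left
  have hexp : ∀ s t : ℝ, Complex.exp (Complex.I * ((s - t : ℝ) : ℂ) / (h : ℂ))
      = Complex.exp (Complex.I * ((-t : ℝ) : ℂ) / h) * Complex.exp (Complex.I * (s : ℂ) / h) := by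
    intro s t
    rw [← Complex.exp_add]
    congr 1
    push_cast
    ring
  set g : ℕ → Conf n → ℂ := fun k x => c k * (Complex.exp (Complex.I * (⟪α k, x⟫_ℝ : ℝ)) * χ x)
    with hg
  have hgcont : ∀ k, Continuous (g k) := fun k => by
    have := hχ.continuous
    fun_prop
  have hgnorm : ∀ k x, ‖g k x‖ = ‖c k‖ * ‖χ x‖ := fun k x => by
    simp only [hg, norm_mul, norm_cexp_I_mul, one_mul]
  have hgc : ∀ k, HasCompactSupport (g k) := fun k => hχc.mul_left.mul_left
  have hgint : ∀ k, Integrable (g k) := fun k => (hgcont k).integrable_of_hasCompactSupport (hgc k)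
  have hχ2 : MemLp χ 2 volume := hχ.continuous.memLp_of_hasCompactSupport hχc
  have hg2 : ∀ k, MemLp (g k) 2 volume := fun k => (hgcont k).memLp_of_hasCompactSupport (hgc k)
  have hE := fun k => memLp_modulatedKernel hh hχ hχc (β k)
  have hE2 : ∀ k, MemLp (fun y => (starRingEnd ℂ) (modulatedKernel h χ (β k) y)) 2 volume :=
    fun k => (hE k).1.star
  let gL : ℕ → L2 n := fun k => (hg2 k).toLp
  let fL : ℕ → L2 n := fun k => (hE2 k).toLp
  have hfn : ∀ k, ‖fL k‖ = (eLpNorm (modulatedKernel h χ 0) 2 volume).toReal := fun k => by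
    rw [Lp.norm_toLp, ← (hE k).2]
    congr 1
    exact eLpNorm_congr_norm_ae (Filter.Eventually.of_forall fun y => RCLike.norm_conj _)
  have hgn : ∀ k, ‖gL k‖ = ‖c k‖ * (eLpNorm χ 2 volume).toReal := fun k => by
    rw [Lp.norm_toLp, eLpNorm_congr_norm_ae (g := c k • χ) (Filter.Eventually.of_forall fun y => by
      rw [hgnorm, Pi.smul_apply, norm_smul]), eLpNorm_const_smul, ENNReal.toReal_mul]
    simp
  have hs : Summable (fun k => ‖fL k‖ * ‖gL k‖) := by
    simp only [hfn, hgn]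
    exact (hc.mul_right _).mul_left _
  obtain ⟨T, hT⟩ := exists_operator_of_rankOne_series hs
  have hinner : ∀ k (v : L2 n), ⟪fL k, v⟫_ℂ = ∫ y, modulatedKernel h χ (β k) y * v y := by
    intro k v
    rw [L2.inner_def]
    refine integral_congr_ae ?_
    filter_upwards [(hE2 k).coeFn_toLp] with y hy
    simp only [fL, hy, RCLike.inner_apply, RCLike.conj_conj, mul_comm]
  have hTosc : IsOscIntOperator φ b h T := by
    intro u hu
    refine Lp.ae_eq_of_hasSum (hT u) ?_
    have hpt : ∀ x, HasSum (fun k => ⟪fL k, u⟫_ℂ * g k x) (oscInt φ b h u x) := by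
      intro x
      have h1 := hasSum_integral_mul_modulatedKernel (h := h) hχ.continuous hχc β
        (w := fun k y => g k x * u y) (fun k => hu.const_mul _) (by
          simp only [norm_mul, integral_const_mul, hgnorm]
          exact (hc.mul_right _).mul_right _)
        (A := fun p => (Complex.exp (Complex.I * (φ (x, p.2) : ℂ) / h) * b (x, p.2)) * u p.1)
        (fun p => ((hsum x p.2).mul_right (u p.1)).congr_fun fun k => by simp only [hg]; ring)
      have h3 : (1 / ((2 * Real.pi * h : ℝ) : ℂ) ^ n) * ∫ p : Conf n × Conf n,
          Complex.exp (Complex.I * ((-⟪p.1, p.2⟫_ℝ : ℝ) : ℂ) / h) *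
            ((Complex.exp (Complex.I * (φ (x, p.2) : ℂ) / h) * b (x, p.2)) * u p.1)
          = oscInt φ b h u x := by
        simp only [oscInt, hexp, mul_assoc]
      rw [h3] at h1
      refine h1.congr_fun fun k => ?_
      rw [hinner, ← integral_mul_const]
      refine integral_congr_ae (Filter.Eventually.of_forall fun y => ?_)
      ring
    have h2 : ∀ᵐ x, ∀ k, (⟪fL k, u⟫_ℂ • gL k : L2 n) x = ⟪fL k, u⟫_ℂ * g k x := by
      rw [ae_all_iff]
      intro k
      filter_upwards [Lp.coeFn_smul (⟪fL k, u⟫_ℂ) (gL k), (hg2 k).coeFn_toLp] with x h1 h2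
      rw [h1, Pi.smul_apply, h2, smul_eq_mul]
    filter_upwards [h2] with x hx
    simp only [hx]
    exact hpt x
  refine ⟨⟨T, hTosc, fun B hB => hB.unique hTosc⟩, fun B hB => ?_⟩
  rw [hB.unique hTosc]
  have htr := hasTrace_of_rankOne_series hs hT
  have h1 := hasSum_integral_mul_modulatedKernel (h := h) hχ.continuous hχc β
    (w := g) hgint (by
      simp only [hgnorm, integral_const_mul]
      exact hc.mul_right _)
    (A := fun p => Complex.exp (Complex.I * (φ p : ℂ) / h) * b p) (fun p => hsum p.1 p.2)
  have h2 : ∀ k, ⟪fL k, gL k⟫_ℂ = ∫ y, modulatedKernel h χ (β k) y * g k y := by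
    intro k
    rw [hinner]
    refine integral_congr_ae ?_
    filter_upwards [(hg2 k).coeFn_toLp] with y hy
    simp only [gL, hy]
  simp only [← h2] at h1
  rw [h1.tsum_eq] at htr
  simpa only [hexp, mul_assoc] using htr

end Operator

/-! ### The Morse lemma -/

section MorseLemma

universe u

/-- Differentiation under the integral sign, to all orders. -/
theorem contDiff_parametric_intervalIntegral {E G : Type u} [NormedAddCommGroup E] [NormedSpace ℝ E]
    [FiniteDimensional ℝ E] [NormedAddCommGroup G] [NormedSpace ℝ G] [CompleteSpace G]
    {F : E × ℝ → G} (hF : ContDiff ℝ ∞ F) :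
    ContDiff ℝ ∞ fun z => ∫ t in (0 : ℝ)..1, F (z, t) := by
  rw [contDiff_infty]
  intro m
  induction m generalizing G with
  | zero =>
    rw [Nat.cast_zero, contDiff_zero]
    exact intervalIntegral.continuous_parametric_intervalIntegral_of_continuous'
      (f := fun z t => F (z, t)) hF.continuous 0 1
  | succ m ih =>
    have hF1 : ContDiff ℝ ∞ (fderiv ℝ F) := hF.fderiv_right (by simp)
    let F' : E × ℝ → E →L[ℝ] G := fun p => (fderiv ℝ F p).comp (ContinuousLinearMap.inl ℝ E ℝ)
    have hF' : ContDiff ℝ ∞ F' := hF1.clm_comp contDiff_const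
    have hder : ∀ p : E × ℝ, HasFDerivAt (fun z => F (z, p.2)) (F' p) p.1 := fun p => by
      have h1 := ((hF.differentiable (by simp)) p).hasFDerivAt
      exact h1.comp p.1 (hasFDerivAt_prodMk_left p.1 p.2)
    rw [Nat.cast_succ, contDiff_succ_iff_hasFDerivAt]
    refine ⟨fun z => ∫ t in (0 : ℝ)..1, F' (z, t), ih hF', fun z₀ => ?_⟩
    have hK : IsCompact (Metric.closedBall z₀ 1 ×ˢ Icc (0 : ℝ) 1) :=
      (isCompact_closedBall z₀ 1).prod isCompact_Icc
    obtain ⟨C, hC⟩ := hK.exists_bound_of_continuousOn hF'.continuous.continuousOn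
    refine (intervalIntegral.hasFDerivAt_integral_of_dominated_of_fderiv_le (𝕜 := ℝ)
      (s := Metric.closedBall z₀ 1) (bound := fun _ => C) (F' := fun z t => F' (z, t))
      (Metric.closedBall_mem_nhds z₀ one_pos) ?_ ?_ ?_ ?_ ?_ ?_)
    · exact Filter.Eventually.of_forall fun z =>
        (hF.continuous.comp (Continuous.prodMk_right z)).aestronglyMeasurable
    · exact (hF.continuous.comp (Continuous.prodMk_right z₀)).intervalIntegrable 0 1
    · exact (hF'.continuous.comp (Continuous.prodMk_right z₀)).aestronglyMeasurable
    · refine Filter.Eventually.of_forall fun t ht z hz => hC (z, t) ⟨hz, ?_⟩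
      rw [uIoc_of_le zero_le_one] at ht
      exact ⟨ht.1.le, ht.2⟩
    · exact intervalIntegrable_const
    · exact Filter.Eventually.of_forall fun t _ z _ => hder (z, t)

variable {E : Type u} [NormedAddCommGroup E] [NormedSpace ℝ E]

/-- Near the identity, squaring in a Banach algebra has an analytic inverse. -/
theorem exists_local_sqrt {R : Type*} [NormedRing R] [NormedAlgebra ℝ R] [CompleteSpace R] :
    ∃ r : R → R, ContDiffAt ℝ ω r 1 ∧ r 1 = 1 ∧
      (∀ᶠ Y in 𝓝 1, r Y * r Y = Y) ∧ ∀ᶠ X in 𝓝 1, r (X * X) = X := by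
  set sq : R → R := fun X => X * X with hsq
  have hsm : ContDiff ℝ ω sq := contDiff_id.mul contDiff_id
  let e : R ≃L[ℝ] R := ContinuousLinearEquiv.smulLeft (Units.mk0 (2 : ℝ) two_ne_zero)
  have he : HasFDerivAt sq (e : R →L[ℝ] R) 1 := by
    have h1 := (hasFDerivAt_id (𝕜 := ℝ) (1 : R)).mul' (hasFDerivAt_id (1 : R))
    refine h1.congr_fderiv ?_
    ext X
    change (1 : R) * X + X * 1 = (2 : ℝ) • X
    rw [one_mul, mul_one, two_smul]
  have hst : HasStrictFDerivAt sq (e : R →L[ℝ] R) 1 :=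
    hsm.contDiffAt.hasStrictFDerivAt' he (by simp)
  have h11 : sq 1 = 1 := by simp [hsq]
  refine ⟨hst.localInverse sq e 1, ?_, ?_, ?_, ?_⟩
  · have := ContDiffAt.to_localInverse (hsm.contDiffAt (x := 1)) he (by simp)
    rwa [h11] at this
  · have := hst.localInverse_apply_image
    rwa [h11] at this
  · have := hst.eventually_right_inverse
    rwa [h11] at this
  · exact hst.eventually_left_inverse

set_option maxSynthPendingDepth 3 in
/-- Taylor's formula of order two with integral remainder, at a critical point of value zero. -/
theorem eq_integral_hessian [FiniteDimensional ℝ E] {ψ : E → ℝ} (hψ : ContDiff ℝ ∞ ψ)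
    (h0 : ψ 0 = 0) (h1 : fderiv ℝ ψ 0 = 0) (z : E) :
    ψ z = (∫ t in (0 : ℝ)..1, (1 - t) • fderiv ℝ (fderiv ℝ ψ) (t • z)) z z := by
  have hH : ContDiff ℝ ∞ (fderiv ℝ (fderiv ℝ ψ)) :=
    (hψ.fderiv_right (m := ∞) (by simp)).fderiv_right (by simp)
  have h := map_add_eq_sum_add_integral_iteratedFDeriv (f := ψ) (x := 0) (y := z) (n := 1)
    fun t _ => (contDiff_infty.1 hψ 2).contDiffAt
  have hint : IntervalIntegrable (fun t : ℝ => (1 - t) • fderiv ℝ (fderiv ℝ ψ) (t • z))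
      volume 0 1 := by
    have := hH.continuous
    exact Continuous.intervalIntegrable (by fun_prop) 0 1
  have h2 := (((ContinuousLinearMap.apply ℝ ℝ z).comp
    (ContinuousLinearMap.apply ℝ (E →L[ℝ] ℝ) z)).intervalIntegral_comp_comm hint)
  simp only [ContinuousLinearMap.comp_apply, ContinuousLinearMap.apply_apply] at h2
  rw [← h2]
  simpa [Finset.sum_range_succ, h0, h1, iteratedFDeriv_two_apply, iteratedFDeriv_one_apply] using h

set_option maxSynthPendingDepth 3 in
/-- **Morse lemma.** A smooth function with a nondegenerate critical point at the origin and
critical value zero is half its Hessian in suitable local coordinates `W`.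

By Taylor's formula `ψ z = A(z)(z, z)` with `A` smooth and `2 A(0) = Λ`, the Hessian. The endomorphism
`C(z) = 2 Λ⁻¹ A(z)` is close to `1` and self-adjoint for `Λ`, hence so is its square root `S(z)`, and
`W z = S(z) z` does it. -/
theorem exists_morse_coordinates [FiniteDimensional ℝ E] {ψ : E → ℝ} (hψ : ContDiff ℝ ∞ ψ)
    (h0 : ψ 0 = 0) (h1 : fderiv ℝ ψ 0 = 0) (Λ : E ≃L[ℝ] (E →L[ℝ] ℝ))
    (hΛ : (Λ : E →L[ℝ] (E →L[ℝ] ℝ)) = fderiv ℝ (fderiv ℝ ψ) 0) :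
    ∃ (W : E → E) (U : Set E), IsOpen U ∧ 0 ∈ U ∧ ContDiffOn ℝ ∞ W U ∧ W 0 = 0 ∧
      HasFDerivAt W (ContinuousLinearMap.id ℝ E) 0 ∧
      ∀ z ∈ U, ψ z = fderiv ℝ (fderiv ℝ ψ) 0 (W z) (W z) / 2 := by
  set H := fderiv ℝ (fderiv ℝ ψ) with hHdef
  have hH : ContDiff ℝ ∞ H := (hψ.fderiv_right (m := ∞) (by simp)).fderiv_right (by simp)
  have hHs : ∀ z v w, H z v w = H z w v := fun z v w =>
    ((((contDiff_infty.1 hψ 2).contDiffAt (x := z))).isSymmSndFDerivAt (n := 2) (by simp)) v w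
  set A : E → E →L[ℝ] E →L[ℝ] ℝ := fun z => ∫ t in (0 : ℝ)..1, (1 - t) • H (t • z) with hA
  have hAsm : ContDiff ℝ ∞ A := by
    refine contDiff_parametric_intervalIntegral (F := fun p : E × ℝ => (1 - p.2) • H (p.2 • p.1)) ?_
    fun_prop
  have hA0 : A 0 = (2 : ℝ)⁻¹ • H 0 := by
    simp only [hA, smul_zero, intervalIntegral.integral_smul_const]
    congr 1
    rw [intervalIntegral.integral_comp_sub_left (fun x : ℝ => x) 1]
    norm_num [integral_id]
  have hAsymm : ∀ z v w, A z v w = A z w v := fun z v w => by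
    have hint : IntervalIntegrable (fun t : ℝ => (1 - t) • H (t • z)) volume 0 1 := by
      have := hH.continuous
      exact Continuous.intervalIntegrable (by fun_prop) 0 1
    have h2 : ∀ v w, A z v w = ∫ t in (0 : ℝ)..1, (1 - t) * H (t • z) v w := fun v w => by
      have := (((ContinuousLinearMap.apply ℝ ℝ w).comp
        (ContinuousLinearMap.apply ℝ (E →L[ℝ] ℝ) v)).intervalIntegral_comp_comm hint)
      simp only [ContinuousLinearMap.comp_apply, ContinuousLinearMap.apply_apply] at this
      simp only [hA, ← this]
      simp
    rw [h2, h2]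
    simp only [hHs _ v w]
  have hΛa : ∀ v w, Λ v w = H 0 v w := fun v w => by
    rw [← hΛ]; rfl
  have hΛs : ∀ v w, Λ v w = Λ w v := fun v w => by rw [hΛa, hΛa, hHs]
  -- `C z` is the endomorphism representing `2 A(z)` through the Hessian at the origin
  set C : E → E →L[ℝ] E := fun z =>
    (Λ.symm : (E →L[ℝ] ℝ) →L[ℝ] E).comp ((2 : ℝ) • A z) with hC
  have hCsm : ContDiff ℝ ∞ C := contDiff_const.clm_comp (hAsm.const_smul (2 : ℝ))
  have hC0 : C 0 = 1 := by
    ext v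
    simp only [hC, hA0, smul_inv_smul₀ (two_ne_zero' ℝ), ← hΛ]
    simp
  have hCΛ : ∀ z v w, Λ (C z v) w = 2 * A z v w := fun z v w => by
    simp [hC]
  -- the adjoint with respect to the Hessian at the origin
  set adj : (E →L[ℝ] E) → (E →L[ℝ] E) := fun X =>
    (Λ.symm : (E →L[ℝ] ℝ) →L[ℝ] E).comp
      (((ContinuousLinearMap.compL ℝ E E ℝ).flip X).comp (Λ : E →L[ℝ] (E →L[ℝ] ℝ))) with hadj
  have hadjΛ : ∀ X v w, Λ (adj X v) w = Λ v (X w) := fun X v w => by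
    simp [hadj]
  have hadjc : Continuous adj := by
    simp only [hadj]
    fun_prop
  have hΛext : ∀ X Y : E →L[ℝ] E, (∀ v w, Λ (X v) w = Λ (Y v) w) → X = Y := fun X Y h => by
    ext v
    exact Λ.injective (ContinuousLinearMap.ext fun w => h v w)
  have hadj1 : adj 1 = 1 := hΛext _ _ fun v w => by rw [hadjΛ]; rfl
  have hadjmul : ∀ X, adj X * adj X = adj (X * X) := fun X => hΛext _ _ fun v w => by
    rw [hadjΛ, mul_apply_eq_comp, mul_apply_eq_comp, hadjΛ, hadjΛ]
  have hadjC : ∀ z, adj (C z) = C z := fun z => hΛext _ _ fun v w => by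
    rw [hadjΛ, hΛs, hCΛ, hCΛ, hAsymm]
  obtain ⟨r, hrsm, hr1, hrsq, hrinv⟩ := exists_local_sqrt (R := E →L[ℝ] E)
  have hCt : Filter.Tendsto C (𝓝 0) (𝓝 1) := by
    have := hCsm.continuous.tendsto 0
    rwa [hC0] at this
  have hrt : Filter.Tendsto r (𝓝 1) (𝓝 1) := by
    have := hrsm.continuousAt.tendsto
    rwa [hr1] at this
  have hadjt : Filter.Tendsto adj (𝓝 1) (𝓝 1) := by
    have := hadjc.tendsto 1
    rwa [hadj1] at this
  have hgood : ∀ᶠ z in 𝓝 (0 : E), ContDiffAt ℝ ∞ r (C z) ∧ r (C z) * r (C z) = C z ∧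
      r (adj (r (C z)) * adj (r (C z))) = adj (r (C z)) := by
    refine Filter.Eventually.and ?_ (Filter.Eventually.and (hCt.eventually hrsq)
      ((hadjt.comp (hrt.comp hCt)).eventually hrinv))
    exact hCt.eventually ((hrsm.eventually (by simp)).mono fun _ h => h.of_le le_top)
  obtain ⟨U, hUsub, hUo, h0U⟩ := mem_nhds_iff.1 hgood
  have hSsm : ContDiffOn ℝ ∞ (fun z => r (C z)) U := fun z hz =>
    ((hUsub hz).1.comp z hCsm.contDiffAt).contDiffWithinAt
  refine ⟨fun z => r (C z) z, U, hUo, h0U, hSsm.clm_apply contDiffOn_id, by simp, ?_, ?_⟩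
  · have hd : DifferentiableAt ℝ (fun z => r (C z)) 0 :=
      (hSsm.contDiffAt (hUo.mem_nhds h0U)).differentiableAt (by simp)
    refine (hd.hasFDerivAt.clm_apply (hasFDerivAt_id 0)).congr_fderiv ?_
    ext v
    simp [hC0, hr1]
  · intro z hz
    obtain ⟨-, hsq, hinv⟩ := hUsub hz
    -- both sides are square roots of `C z` close to the identity
    have hself : adj (r (C z)) = r (C z) := by
      rw [← hinv, hadjmul, hsq, hadjC]
    have h3 : Λ (r (C z) z) (r (C z) z) = Λ z (C z z) := by
      conv_rhs => rw [← hsq]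
      rw [mul_apply_eq_comp, ← hadjΛ, hself]
      exact hΛs _ _
    rw [← hΛa, h3, hΛs, hCΛ, eq_integral_hessian hψ h0 h1 z]
    ring

end MorseLemma

/-! ### Non-stationary phase -/

section OscillatoryIntegrals

universe u

variable {E : Type u} [NormedAddCommGroup E] [NormedSpace ℝ E]

theorem ContDiffOn.contDiff_mul_of_tsupport_subset {Ω : Set E} (hΩ : IsOpen Ω) {g a : E → ℂ}
    (hg : ContDiffOn ℝ ∞ g Ω) (ha : ContDiff ℝ ∞ a) (hsupp : tsupport a ⊆ Ω) :
    ContDiff ℝ ∞ fun z => g z * a z := by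
  rw [contDiff_iff_contDiffAt]
  intro z
  by_cases hz : z ∈ tsupport a
  · exact (hg.contDiffAt (hΩ.mem_nhds (hsupp hz))).mul ha.contDiffAt
  · have h0 : (fun z => g z * a z) =ᶠ[𝓝 z] fun _ => 0 := by
      filter_upwards [notMem_tsupport_iff_eventuallyEq.1 hz] with y hy
      simp [hy]
    exact contDiffAt_const.congr_of_eventuallyEq h0

theorem contDiffOn_cexp_phase {Ω : Set E} {ψ : E → ℝ} (hψ : ContDiffOn ℝ ∞ ψ Ω) (h : ℝ) :
    ContDiffOn ℝ ∞ (fun z => Complex.exp (Complex.I * (ψ z : ℂ) / (h : ℂ))) Ω :=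
  ((contDiffOn_const.mul (Complex.ofRealCLM.contDiff.comp_contDiffOn hψ)).div_const _).cexp

variable [FiniteDimensional ℝ E] [MeasurableSpace E] [BorelSpace E]

theorem integral_fderiv_apply_eq_zero (μ : Measure E) [μ.IsAddHaarMeasure] {F : E → ℂ}
    (hF : ContDiff ℝ ∞ F) (hFc : HasCompactSupport F) (v : E) : ∫ z, fderiv ℝ F z v ∂μ = 0 := by
  have h1 : Continuous fun z => fderiv ℝ F z v :=
    (hF.continuous_fderiv (by simp)).clm_apply continuous_const
  have h := integral_mul_fderiv_eq_neg_fderiv_mul_of_integrable (𝕜 := ℂ) (μ := μ)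
    (f := fun _ : E => (1 : ℂ)) (g := F) (v := v) (by simp)
    (by simpa using h1.integrable_of_hasCompactSupport (hFc.fderiv_apply (𝕜 := ℝ) v))
    (by simpa using hF.continuous.integrable_of_hasCompactSupport hFc)
    (fun _ _ => differentiableAt_const _) (fun z _ => hF.differentiable (by simp) z)
  simpa using h

/-- One integration by parts gains a factor `h`. It uses the vector field `∑ᵢ qᵢ ∂ᵢ` with
`qᵢ = a ∂ᵢψ / ∑ⱼ (∂ⱼψ)²`, which maps `e^{iψ/h}` to `(i/h) e^{iψ/h} a`. -/
theorem exists_integral_eq_mul_integral (μ : Measure E) [μ.IsAddHaarMeasure] {Ω : Set E}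
    (hΩ : IsOpen Ω) {ψ : E → ℝ} (hψ : ContDiffOn ℝ ∞ ψ Ω) (hnc : ∀ z ∈ Ω, fderiv ℝ ψ z ≠ 0)
    {a : E → ℂ} (ha : ContDiff ℝ ∞ a) (hac : HasCompactSupport a) (hsupp : tsupport a ⊆ Ω) :
    ∃ a' : E → ℂ, ContDiff ℝ ∞ a' ∧ HasCompactSupport a' ∧ tsupport a' ⊆ Ω ∧
      ∀ h : ℝ, h ≠ 0 → ∫ z, Complex.exp (Complex.I * (ψ z : ℂ) / (h : ℂ)) * a z ∂μ
        = h * ∫ z, Complex.exp (Complex.I * (ψ z : ℂ) / (h : ℂ)) * a' z ∂μ := by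
  let e := Module.finBasis ℝ E
  set g : Fin (Module.finrank ℝ E) → E → ℝ := fun i z => fderiv ℝ ψ z (e i) with hg
  set Nm : E → ℝ := fun z => ∑ i, g i z ^ 2 with hNm
  have hgsm : ∀ i, ContDiffOn ℝ ∞ (g i) Ω := fun i =>
    (hψ.fderiv_of_isOpen hΩ (by simp)).clm_apply contDiffOn_const
  have hNsm : ContDiffOn ℝ ∞ Nm Ω := ContDiffOn.sum fun i _ => (hgsm i).pow 2
  have hNpos : ∀ z ∈ Ω, Nm z ≠ 0 := fun z hz h0 => by
    refine hnc z hz ?_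
    have h1 := (Finset.sum_eq_zero_iff_of_nonneg fun i _ => sq_nonneg (g i z)).1 h0
    refine ContinuousLinearMap.coe_injective (e.ext fun i => ?_)
    simpa using h1 i (Finset.mem_univ i)
  set q : Fin (Module.finrank ℝ E) → E → ℂ := fun i z => ((g i z / Nm z : ℝ) : ℂ) * a z with hq
  have hqsm : ∀ i, ContDiff ℝ ∞ (q i) := fun i =>
    ContDiffOn.contDiff_mul_of_tsupport_subset hΩ
      (Complex.ofRealCLM.contDiff.comp_contDiffOn ((hgsm i).div hNsm hNpos)) ha hsupp
  have hqs : ∀ i, tsupport (q i) ⊆ tsupport a := fun i => tsupport_mul_subset_right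
  have hqc : ∀ i, HasCompactSupport (q i) := fun i => hac.mul_left
  have hdq : ∀ i, ContDiff ℝ ∞ fun z => fderiv ℝ (q i) z (e i) := fun i =>
    ((hqsm i).fderiv_right (by simp)).clm_apply contDiff_const
  have hdqs : ∀ i, tsupport (fun z => fderiv ℝ (q i) z (e i)) ⊆ tsupport a := fun i =>
    (tsupport_fderiv_apply_subset ℝ (e i)).trans (hqs i)
  have ha's : tsupport (fun z => Complex.I * ∑ i, fderiv ℝ (q i) z (e i)) ⊆ tsupport a := by
    refine closure_minimal (fun z hz => ?_) (isClosed_tsupport a)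
    by_contra hcon
    refine hz ?_
    simp only
    rw [Finset.sum_eq_zero, mul_zero]
    exact fun i _ => image_eq_zero_of_notMem_tsupport (f := fun z => fderiv ℝ (q i) z (e i))
      fun h => hcon (hdqs i h)
  refine ⟨fun z => Complex.I * ∑ i, fderiv ℝ (q i) z (e i),
    contDiff_const.mul (ContDiff.sum fun i _ => hdq i), hac.mono' (subset_tsupport _ |>.trans ha's),
    ha's.trans hsupp, fun h hh => ?_⟩
  set ex : E → ℂ := fun z => Complex.exp (Complex.I * (ψ z : ℂ) / (h : ℂ)) with hex
  have hexsm : ContDiffOn ℝ ∞ ex Ω := contDiffOn_cexp_phase hψ h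
  -- the divergence of `e^{iψ/h} q`, whose integral vanishes
  have hpt : ∀ z, ∑ i, fderiv ℝ (fun z => ex z * q i z) z (e i)
      = Complex.I / h * (ex z * a z) + ex z * ∑ i, fderiv ℝ (q i) z (e i) := by
    intro z
    by_cases hz : z ∈ tsupport a
    · have hzΩ := hsupp hz
      have hψd : HasFDerivAt ψ (fderiv ℝ ψ z) z :=
        ((hψ.contDiffAt (hΩ.mem_nhds hzΩ)).differentiableAt (by simp)).hasFDerivAt
      have hexd : ∀ v, fderiv ℝ ex z v = Complex.I / h * (fderiv ℝ ψ z v : ℝ) * ex z := fun v => by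
        have h1 := ((Complex.ofRealCLM.hasFDerivAt.comp z hψd).const_mul (Complex.I / h)).cexp
        have h2 : ex = fun y => Complex.exp (Complex.I / h * (Complex.ofRealCLM ∘ ψ) y) := by
          funext y
          simp only [hex, Function.comp_apply, Complex.ofRealCLM_apply]
          congr 1
          ring
        rw [← h2] at h1
        rw [h1.fderiv]
        simp only [hex, smul_apply, ContinuousLinearMap.comp_apply, Complex.ofRealCLM_apply,
          Function.comp_apply, smul_eq_mul]
        rw [mul_comm, mul_div_right_comm]
      have h2 : ∀ i, fderiv ℝ (fun z => ex z * q i z) z (e i)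
          = Complex.I / h * ((g i z ^ 2 / Nm z : ℝ) : ℂ) * (ex z * a z)
            + ex z * fderiv ℝ (q i) z (e i) := fun i => by
        rw [fderiv_fun_mul ((hexsm.contDiffAt (hΩ.mem_nhds hzΩ)).differentiableAt (by simp))
          ((hqsm i).differentiable (by simp) z)]
        simp only [add_apply, smul_apply, smul_eq_mul, hexd, hq]
        push_cast
        ring
      simp only [h2, Finset.sum_add_distrib, ← Finset.mul_sum, ← Finset.sum_mul]
      congr 1
      rw [← Complex.ofReal_sum, ← Finset.sum_div, div_self (hNpos z hzΩ)]
      simp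
    · have h0 : ∀ i, fderiv ℝ (fun z => ex z * q i z) z (e i) = 0 := fun i => by
        refine image_eq_zero_of_notMem_tsupport (f := fun z => fderiv ℝ (fun z => ex z * q i z) z (e i))
          fun hcon => hz ?_
        exact hqs i (tsupport_mul_subset_right (tsupport_fderiv_apply_subset ℝ (e i) hcon))
      have h1 : ∀ i, fderiv ℝ (q i) z (e i) = 0 := fun i =>
        image_eq_zero_of_notMem_tsupport (f := fun z => fderiv ℝ (q i) z (e i))
          fun hcon => hz (hdqs i hcon)
      simp [h0, h1, image_eq_zero_of_notMem_tsupport hz]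
  have hFsm : ∀ i, ContDiff ℝ ∞ fun z => ex z * q i z := fun i =>
    hexsm.contDiff_mul_of_tsupport_subset hΩ (hqsm i) ((hqs i).trans hsupp)
  have hint1 : Integrable (fun z => ex z * a z) μ :=
    (hexsm.contDiff_mul_of_tsupport_subset hΩ ha hsupp).continuous.integrable_of_hasCompactSupport
      hac.mul_left
  have hFint : ∀ i, Integrable (fun z => fderiv ℝ (fun z => ex z * q i z) z (e i)) μ := fun i =>
    (((hFsm i).continuous_fderiv (by simp)).clm_apply
      continuous_const).integrable_of_hasCompactSupport ((hqc i).mul_left.fderiv_apply ℝ (e i))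
  have hint2 : Integrable (fun z => ex z * ∑ i, fderiv ℝ (q i) z (e i)) μ := by
    refine ((integrable_finsetSum Finset.univ fun i _ => hFint i).sub
      (hint1.const_mul (Complex.I / h))).congr (Filter.Eventually.of_forall fun z => ?_)
    rw [Pi.sub_apply, hpt]
    ring
  have hzero : ∫ z, ∑ i, fderiv ℝ (fun z => ex z * q i z) z (e i) ∂μ = 0 := by
    rw [integral_finsetSum]
    · exact Finset.sum_eq_zero fun i _ =>
        integral_fderiv_apply_eq_zero μ (hFsm i) (hqc i).mul_left (e i)
    · exact fun i _ => hFint i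
  simp only [hpt] at hzero
  rw [integral_add (hint1.const_mul _) hint2, integral_const_mul] at hzero
  have hh' : (h : ℂ) ≠ 0 := by exact_mod_cast hh
  simp only [mul_left_comm _ Complex.I, integral_const_mul]
  field_simp at hzero
  linear_combination (-Complex.I) * hzero + (∫ z, ex z * a z ∂μ) * (Complex.I_mul_I)

/-- **Non-stationary phase**: without critical points in the support of the amplitude, the integral
is `O(h^N)` for every `N`. -/
theorem norm_integral_le_of_no_critical_point (μ : Measure E) [μ.IsAddHaarMeasure] {Ω : Set E}
    (hΩ : IsOpen Ω) {ψ : E → ℝ} (hψ : ContDiffOn ℝ ∞ ψ Ω) (hnc : ∀ z ∈ Ω, fderiv ℝ ψ z ≠ 0)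
    (N : ℕ) {a : E → ℂ} (ha : ContDiff ℝ ∞ a) (hac : HasCompactSupport a)
    (hsupp : tsupport a ⊆ Ω) :
    ∃ C : ℝ, ∀ h : ℝ, 0 < h →
      ‖∫ z, Complex.exp (Complex.I * (ψ z : ℂ) / (h : ℂ)) * a z ∂μ‖ ≤ C * h ^ N := by
  induction N generalizing a with
  | zero =>
    refine ⟨∫ z, ‖a z‖ ∂μ, fun h _ => ?_⟩
    refine (norm_integral_le_integral_norm _).trans_eq ?_
    simp only [norm_mul, norm_cexp_I_mul_div, one_mul, pow_zero, mul_one]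
  | succ N ih =>
    obtain ⟨a', ha', hac', hs', heq⟩ := exists_integral_eq_mul_integral μ hΩ hψ hnc ha hac hsupp
    obtain ⟨C, hC⟩ := ih ha' hac' hs'
    refine ⟨C, fun h hh => ?_⟩
    rw [heq h hh.ne', norm_mul, Complex.norm_real, Real.norm_of_nonneg hh.le]
    calc h * _ ≤ h * (C * h ^ N) := by gcongr; exact hC h hh
      _ = C * h ^ (N + 1) := by ring

end OscillatoryIntegrals

/-! ### Reduction to a quadratic phase -/

section MorseReduction

universe u

variable {E : Type u} [NormedAddCommGroup E] [NormedSpace ℝ E] [FiniteDimensional ℝ E]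

theorem contDiff_continuousLinearMap_det : ContDiff ℝ ∞ fun A : E →L[ℝ] E => A.det := by
  classical
  let e := Module.finBasis ℝ E
  have h : (fun A : E →L[ℝ] E => A.det) = fun A => ∑ σ : Equiv.Perm (Fin (Module.finrank ℝ E)),
      ((Equiv.Perm.sign σ : ℤ) : ℝ) * ∏ i, e.coord (σ i) (A (e i)) := by
    funext A
    rw [ContinuousLinearMap.det, ← LinearMap.det_toMatrix e, Matrix.det_apply']
    simp [LinearMap.toMatrix_apply]
  rw [h]
  refine ContDiff.sum fun σ _ => contDiff_const.mul (contDiff_prod fun i _ => ?_)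
  exact (LinearMap.toContinuousLinearMap (e.coord (σ i))).contDiff.comp
    (ContinuousLinearMap.apply ℝ E (e i)).contDiff

variable [MeasurableSpace E] [BorelSpace E]

/-- Localization near a nondegenerate critical point: for an amplitude supported where the Morse
coordinates `W` are defined, the change of variables `w = W z` makes the phase purely quadratic. The
Jacobian of `W` is `1` at the origin, so the value of the amplitude there does not change. -/
theorem exists_neighborhood_integral_eq_quadratic (μ : Measure E) [μ.IsAddHaarMeasure]
    {Ω : Set E} (hΩ : IsOpen Ω) (h0Ω : 0 ∈ Ω) {ψ : E → ℝ} (hψ : ContDiffOn ℝ ∞ ψ Ω)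
    (h1 : fderiv ℝ ψ 0 = 0) (Λ : E ≃L[ℝ] (E →L[ℝ] ℝ))
    (hΛ : (Λ : E →L[ℝ] (E →L[ℝ] ℝ)) = fderiv ℝ (fderiv ℝ ψ) 0) :
    ∃ V : Set E, IsOpen V ∧ 0 ∈ V ∧ ∀ a : E → ℂ, ContDiff ℝ ∞ a → HasCompactSupport a →
      tsupport a ⊆ V → ∃ f : E → ℂ, ContDiff ℝ ∞ f ∧ HasCompactSupport f ∧ f 0 = a 0 ∧
        ∀ h : ℝ, ∫ z, Complex.exp (Complex.I * (ψ z : ℂ) / (h : ℂ)) * a z ∂μ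
          = Complex.exp (Complex.I * (ψ 0 : ℂ) / (h : ℂ)) *
            ∫ w, Complex.exp (Complex.I * ((Λ w w / 2 : ℝ) : ℂ) / (h : ℂ)) * f w ∂μ := by
  -- a globally smooth phase that agrees with `ψ - ψ 0` near the origin
  obtain ⟨ψ', hψ', hloc⟩ : ∃ ψ' : E → ℝ, ContDiff ℝ ∞ ψ' ∧ ψ' =ᶠ[𝓝 0] fun z => ψ z - ψ 0 := by
    obtain ⟨ρ, hρ, hρΩ⟩ := Metric.nhds_basis_closedBall.mem_iff.1 (hΩ.mem_nhds h0Ω)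
    let χ : ContDiffBump (0 : E) := ⟨ρ / 2, ρ, by positivity, by linarith⟩
    refine ⟨fun z => (ψ z - ψ 0) * χ z, ?_, ?_⟩
    · rw [contDiff_iff_contDiffAt]
      intro z
      by_cases hz : z ∈ tsupport χ
      · rw [χ.tsupport_eq] at hz
        exact ((hψ.contDiffAt (hΩ.mem_nhds (hρΩ hz))).sub contDiffAt_const).mul χ.contDiffAt
      · refine (contDiffAt_const (c := (0 : ℝ))).congr_of_eventuallyEq ?_
        filter_upwards [notMem_tsupport_iff_eventuallyEq.1 hz] with y hy
        simp [hy]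
    · filter_upwards [χ.eventuallyEq_one] with z hz
      simp [hz]
  have hd1 : fderiv ℝ ψ' =ᶠ[𝓝 0] fderiv ℝ ψ := by
    filter_upwards [hloc.fderiv (𝕜 := ℝ)] with z hz
    rw [hz, fderiv_sub_const]
  have hd2 : fderiv ℝ (fderiv ℝ ψ') 0 = fderiv ℝ (fderiv ℝ ψ) 0 := hd1.fderiv_eq
  obtain ⟨W, U, hU, h0U, hW, hW0, hWd, hWψ⟩ := exists_morse_coordinates hψ'
    (by simpa using hloc.self_of_nhds) (by rw [hd1.self_of_nhds, h1]) Λ (by rw [hd2, hΛ])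
  rw [hd2, ← hΛ] at hWψ
  have hWat : ContDiffAt ℝ ∞ W 0 := hW.contDiffAt (hU.mem_nhds h0U)
  have hWd' : HasFDerivAt W ((ContinuousLinearEquiv.refl ℝ E : E ≃L[ℝ] E) : E →L[ℝ] E) 0 := hWd
  let e := hWat.toOpenPartialHomeomorph W hWd' (by simp)
  -- shrink to where the Jacobian is positive
  have hdet : ∀ᶠ z in 𝓝 (0 : E), 0 < (fderiv ℝ W z).det := by
    have hc : ContinuousAt (fun z => (fderiv ℝ W z).det) 0 :=
      (contDiff_continuousLinearMap_det (E := E)).continuous.continuousAt.comp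
        (hWat.fderiv_right (m := 0) (by simp)).continuousAt
    refine hc.eventually (lt_mem_nhds ?_)
    simp [hWd.fderiv, ContinuousLinearMap.det]
  have hnear : ∀ᶠ z in 𝓝 (0 : E), z ∈ U ∧ z ∈ e.source ∧ ψ' z = ψ z - ψ 0 ∧
      0 < (fderiv ℝ W z).det := by
    filter_upwards [hU.mem_nhds h0U, e.open_source.mem_nhds
      (ContDiffAt.mem_toOpenPartialHomeomorph_source hWat hWd' (by simp)), hloc, hdet]
      with z h1 h2 h3 h4 using ⟨h1, h2, h3, h4⟩
  obtain ⟨V, hVsub, hV, h0V⟩ := mem_nhds_iff.1 hnear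
  refine ⟨V, hV, h0V, fun a ha hac hsupp => ?_⟩
  let e' := e.restrOpen V hV
  have he'W : ∀ z, e' z = W z := fun _ => rfl
  have hsrc : e'.source = V := by
    rw [OpenPartialHomeomorph.restrOpen_source]
    exact inter_eq_right.2 fun z hz => (hVsub hz).2.1
  have hinj : InjOn W V := by
    have := e'.injOn
    rwa [hsrc] at this
  have hWV : ∀ z ∈ V, ContDiffAt ℝ ∞ W z := fun z hz =>
    hW.contDiffAt (hU.mem_nhds (hVsub hz).1)
  set J : E → ℝ := fun z => (fderiv ℝ W z).det with hJ
  have hJpos : ∀ z ∈ V, 0 < J z := fun z hz => (hVsub hz).2.2.2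
  have hJsm : ContDiffOn ℝ ∞ J V := fun z hz =>
    (contDiff_continuousLinearMap_det.contDiffAt.comp z
      ((hWV z hz).fderiv_right (by simp))).contDiffWithinAt
  set a₁ : E → ℂ := fun z => (((J z)⁻¹ : ℝ) : ℂ) * a z with ha₁
  have ha₁sm : ContDiff ℝ ∞ a₁ := ContDiffOn.contDiff_mul_of_tsupport_subset hV
    (Complex.ofRealCLM.contDiff.comp_contDiffOn (hJsm.inv fun z hz => (hJpos z hz).ne')) ha hsupp
  have ha₁c : HasCompactSupport a₁ := hac.mul_left
  have ha₁s : tsupport a₁ ⊆ V := tsupport_mul_subset_right.trans hsupp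
  classical
  -- the amplitude in the coordinates `w`, extended by zero
  set f : E → ℂ := fun w => if w ∈ e'.target then a₁ (e'.symm w) else 0 with hf
  have hfW : ∀ z ∈ V, f (W z) = a₁ z := fun z hz => by
    have hz' : z ∈ e'.source := by rwa [hsrc]
    rw [← he'W, hf]
    simp only [if_pos (e'.map_source hz'), e'.left_inv hz']
  have hK : IsCompact (W '' tsupport a₁) :=
    ha₁c.isCompact.image_of_continuousOn fun z hz =>
      (hWV z (ha₁s hz)).continuousAt.continuousWithinAt
  have hf0 : ∀ w, w ∉ W '' tsupport a₁ → f w = 0 := fun w hw => by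
    simp only [hf]
    split_ifs with hwt
    · refine image_eq_zero_of_notMem_tsupport fun hcon => hw ⟨_, hcon, ?_⟩
      rw [← he'W, e'.right_inv hwt]
    · rfl
  have hfsm : ContDiff ℝ ∞ f := by
    rw [contDiff_iff_contDiffAt]
    intro w
    by_cases hw : w ∈ W '' tsupport a₁
    · obtain ⟨z, hz, rfl⟩ := hw
      have hzV := ha₁s hz
      have hz' : z ∈ e'.source := by rwa [hsrc]
      have hwt : W z ∈ e'.target := e'.map_source hz'
      have hder : HasFDerivAt W ((fderiv ℝ W z).toContinuousLinearEquivOfDetNeZero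
          (hJpos z hzV).ne' : E →L[ℝ] E) z := by
        rw [ContinuousLinearMap.coe_toContinuousLinearEquivOfDetNeZero]
        exact ((hWV z hzV).differentiableAt (by simp)).hasFDerivAt
      have hsymm : e'.symm (W z) = z := e'.left_inv hz'
      have hinv : ContDiffAt ℝ ∞ e'.symm (W z) := by
        refine e'.contDiffAt_symm hwt (by rw [hsymm]; exact hder) ?_
        rw [hsymm]
        exact hWV z hzV
      refine (ha₁sm.contDiffAt.comp (W z) hinv).congr_of_eventuallyEq ?_
      filter_upwards [e'.open_target.mem_nhds hwt] with y hy
      simp [hf, hy]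
    · refine (contDiffAt_const (c := (0 : ℂ))).congr_of_eventuallyEq ?_
      filter_upwards [hK.isClosed.isOpen_compl.mem_nhds hw] with y hy using hf0 y hy
  refine ⟨f, hfsm, HasCompactSupport.of_support_subset_isCompact hK fun w hw => ?_, ?_, fun h => ?_⟩
  · by_contra hcon
    exact hw (hf0 w hcon)
  · have := hfW 0 h0V
    rw [hW0] at this
    rw [this, ha₁]
    simp [hJ, hWd.fderiv, ContinuousLinearMap.det]
  · have hL : ∫ z, Complex.exp (Complex.I * (ψ z : ℂ) / (h : ℂ)) * a z ∂μ
        = ∫ z in V, Complex.exp (Complex.I * (ψ z : ℂ) / (h : ℂ)) * a z ∂μ := by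
      refine (setIntegral_eq_integral_of_forall_compl_eq_zero fun z hz => ?_).symm
      rw [image_eq_zero_of_notMem_tsupport fun hcon => hz (hsupp hcon), mul_zero]
    have hR : ∫ w, Complex.exp (Complex.I * ((Λ w w / 2 : ℝ) : ℂ) / (h : ℂ)) * f w ∂μ
        = ∫ w in W '' V, Complex.exp (Complex.I * ((Λ w w / 2 : ℝ) : ℂ) / (h : ℂ)) * f w ∂μ := by
      refine (setIntegral_eq_integral_of_forall_compl_eq_zero fun w hw => ?_).symm
      rw [hf0 w fun hcon => hw (image_mono ha₁s hcon), mul_zero]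
    rw [hL, hR, integral_image_eq_integral_abs_det_fderiv_smul μ hV.measurableSet
      (fun z hz => ((hWV z hz).differentiableAt (by simp)).hasFDerivAt.hasFDerivWithinAt) hinj,
      ← integral_const_mul]
    refine setIntegral_congr_fun hV.measurableSet fun z hz => ?_
    have hJz := hJpos z hz
    have hJz' : ((J z : ℝ) : ℂ) ≠ 0 := by exact_mod_cast hJz.ne'
    have hψz : ψ z = ψ 0 + Λ (W z) (W z) / 2 := by
      have h2 := hWψ z (hVsub hz).1
      rw [(hVsub hz).2.2.1] at h2
      have h3 : ψ z - ψ 0 = Λ (W z) (W z) / 2 := h2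
      linarith
    change _ = _ * (|J z| • _)
    simp only [hfW z hz, ha₁]
    rw [abs_of_pos hJz, hψz, Complex.real_smul, Complex.ofReal_add, mul_add, add_div,
      Complex.exp_add]
    push_cast
    field_simp

/-- Up to `O(h^∞)`, an oscillatory integral whose only critical point is nondegenerate equals one
with quadratic phase. -/
theorem exists_integral_sub_quadratic_le (μ : Measure E) [μ.IsAddHaarMeasure]
    {Ω : Set E} (hΩ : IsOpen Ω) (h0Ω : 0 ∈ Ω) {ψ : E → ℝ} (hψ : ContDiffOn ℝ ∞ ψ Ω)
    (h1 : fderiv ℝ ψ 0 = 0) (hcrit : ∀ z ∈ Ω, fderiv ℝ ψ z = 0 → z = 0)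
    (Λ : E ≃L[ℝ] (E →L[ℝ] ℝ)) (hΛ : (Λ : E →L[ℝ] (E →L[ℝ] ℝ)) = fderiv ℝ (fderiv ℝ ψ) 0)
    {a : E → ℂ} (ha : ContDiff ℝ ∞ a) (hac : HasCompactSupport a) (hsupp : tsupport a ⊆ Ω) (N : ℕ) :
    ∃ (f : E → ℂ) (C : ℝ), ContDiff ℝ ∞ f ∧ HasCompactSupport f ∧ f 0 = a 0 ∧
      ∀ h : ℝ, 0 < h → ‖∫ z, Complex.exp (Complex.I * (ψ z : ℂ) / (h : ℂ)) * a z ∂μ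
          - Complex.exp (Complex.I * (ψ 0 : ℂ) / (h : ℂ)) *
            ∫ w, Complex.exp (Complex.I * ((Λ w w / 2 : ℝ) : ℂ) / (h : ℂ)) * f w ∂μ‖
        ≤ C * h ^ N := by
  obtain ⟨V, hV, h0V, hloc⟩ := exists_neighborhood_integral_eq_quadratic μ hΩ h0Ω hψ h1 Λ hΛ
  obtain ⟨ρ, hρ, hρV⟩ := Metric.nhds_basis_closedBall.mem_iff.1 (hV.mem_nhds h0V)
  let χ : ContDiffBump (0 : E) := ⟨ρ / 2, ρ, by positivity, by linarith⟩
  have hχsm : ContDiff ℝ ∞ fun z => (χ z : ℂ) := Complex.ofRealCLM.contDiff.comp χ.contDiff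
  have hχs : tsupport (fun z => (χ z : ℂ)) ⊆ V := by
    refine (closure_mono (fun z hz => ?_)).trans (χ.tsupport_eq.subset.trans hρV)
    exact fun h0 => hz (by simp [h0])
  -- `a₁` lives in the Morse chart, `a₂` away from the critical point
  set a₁ : E → ℂ := fun z => (χ z : ℂ) * a z with ha₁
  set a₂ : E → ℂ := fun z => (1 - (χ z : ℂ)) * a z with ha₂
  have ha₁sm : ContDiff ℝ ∞ a₁ := hχsm.mul ha
  have ha₂sm : ContDiff ℝ ∞ a₂ := (contDiff_const.sub hχsm).mul ha
  obtain ⟨f, hf, hfc, hf0, hfint⟩ := hloc a₁ ha₁sm hac.mul_left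
    (tsupport_mul_subset_left.trans hχs)
  have hs₂ : tsupport a₂ ⊆ Ω \ {0} := by
    refine fun z hz => ⟨hsupp (tsupport_mul_subset_right hz), fun h0 => ?_⟩
    rw [mem_singleton_iff] at h0
    subst h0
    refine notMem_tsupport_iff_eventuallyEq.2 ?_ hz
    filter_upwards [χ.eventuallyEq_one] with z hz
    simp [ha₂, hz]
  obtain ⟨C, hC⟩ := norm_integral_le_of_no_critical_point μ (hΩ.sdiff isClosed_singleton)
    (hψ.mono sdiff_subset) (fun z hz h0 => hz.2 (hcrit z hz.1 h0)) N ha₂sm hac.mul_left hs₂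
  refine ⟨f, C, hf, hfc, ?_, fun h hh => ?_⟩
  · rw [hf0, ha₁]
    simp [χ.eventuallyEq_one.self_of_nhds]
  · have hex := contDiffOn_cexp_phase hψ h
    have hi₁ : Integrable (fun z => Complex.exp (Complex.I * (ψ z : ℂ) / (h : ℂ)) * a₁ z) μ :=
      (hex.contDiff_mul_of_tsupport_subset hΩ ha₁sm
        (tsupport_mul_subset_right.trans hsupp)).continuous.integrable_of_hasCompactSupport
        hac.mul_left.mul_left
    have hi₂ : Integrable (fun z => Complex.exp (Complex.I * (ψ z : ℂ) / (h : ℂ)) * a₂ z) μ :=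
      (hex.contDiff_mul_of_tsupport_subset hΩ ha₂sm
        (tsupport_mul_subset_right.trans hsupp)).continuous.integrable_of_hasCompactSupport
        hac.mul_left.mul_left
    have hsplit : ∫ z, Complex.exp (Complex.I * (ψ z : ℂ) / (h : ℂ)) * a z ∂μ
        = ∫ z, Complex.exp (Complex.I * (ψ z : ℂ) / (h : ℂ)) * a₁ z ∂μ
          + ∫ z, Complex.exp (Complex.I * (ψ z : ℂ) / (h : ℂ)) * a₂ z ∂μ := by
      rw [← integral_add hi₁ hi₂]
      refine integral_congr_ae (Filter.Eventually.of_forall fun z => ?_)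
      simp only [ha₁, ha₂]
      ring
    rw [hsplit, hfint, add_sub_cancel_left]
    exact hC h hh

end MorseReduction

/-! ### Fresnel integrals -/

section QuadraticPhase

variable {ι : Type*} [Fintype ι]

/-- The inverse Fourier transform of a Gaussian with complex widths `bⱼ`, `Re bⱼ > 0`. -/
theorem integral_gaussian_mul_character {b : ι → ℂ} (hb : ∀ j, 0 < (b j).re)
    (ξ : EuclideanSpace ℝ ι) :
    ∫ w : EuclideanSpace ℝ ι, Complex.exp (-∑ j, b j * (w j : ℂ) ^ 2) *
        (Real.fourierChar ⟪ξ, w⟫_ℝ : ℂ)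
      = (∏ j, (Real.pi / b j) ^ (1 / 2 : ℂ)) *
        Complex.exp (-∑ j, Real.pi ^ 2 * (ξ j : ℂ) ^ 2 / b j) := by
  have h := GaussianFourier.integral_cexp_neg_sum_mul_add hb
    (fun j => 2 * Real.pi * Complex.I * (ξ j : ℂ))
  rw [Finset.prod_mul_distrib, ← Complex.exp_sum] at h
  rw [← (PiLp.volume_preserving_toLp ι).integral_comp
    (MeasurableEquiv.toLp 2 (ι → ℝ)).measurableEmbedding]
  convert h using 1
  · refine integral_congr_ae (Filter.Eventually.of_forall fun w => ?_)
    change Complex.exp _ * (Real.fourierChar _ : ℂ) = _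
    rw [Real.fourierChar_apply, ← Complex.exp_add]
    congr 2
    rw [PiLp.inner_apply]
    simp only [RCLike.inner_apply, conj_trivial]
    push_cast
    rw [Finset.mul_sum, Finset.sum_mul]
    refine Finset.sum_congr rfl fun j _ => ?_
    ring
  · congr 2
    rw [← Finset.sum_neg_distrib]
    refine Finset.sum_congr rfl fun j _ => ?_
    have hj : b j ≠ 0 := fun h0 => by
      have := hb j
      simp [h0] at this
    field_simp
    ring_nf
    rw [Complex.I_sq]
    ring

/-- Parseval's formula for a Gaussian factor with complex width. -/
theorem integral_gaussian_mul_eq {b : ι → ℂ} (hb : ∀ j, 0 < (b j).re)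
    (f : SchwartzMap (EuclideanSpace ℝ ι) ℂ) :
    ∫ w, Complex.exp (-∑ j, b j * (w j : ℂ) ^ 2) * f w
      = (∏ j, (Real.pi / b j) ^ (1 / 2 : ℂ)) *
        ∫ ξ, Complex.exp (-∑ j, Real.pi ^ 2 * (ξ j : ℂ) ^ 2 / b j) * (𝓕 f) ξ := by
  have hinv : ∀ w, f w = ∫ ξ, (Real.fourierChar ⟪ξ, w⟫_ℝ : ℂ) * (𝓕 f) ξ := fun w => by
    have h1 : (𝓕⁻ (𝓕 f) : SchwartzMap (EuclideanSpace ℝ ι) ℂ) w = f w := by simp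
    rw [← h1, SchwartzMap.fourierInv_coe, Real.fourierInv_eq]
    rfl
  have hG : Integrable fun w : EuclideanSpace ℝ ι => Complex.exp (-∑ j, b j * (w j : ℂ) ^ 2) := by
    rw [← (PiLp.volume_preserving_toLp ι).integrable_comp_emb
      (MeasurableEquiv.toLp 2 (ι → ℝ)).measurableEmbedding]
    simpa using! GaussianFourier.integrable_cexp_neg_sum_mul_add hb 0
  let F : EuclideanSpace ℝ ι → EuclideanSpace ℝ ι → ℂ := fun w ξ =>
    (Real.fourierChar ⟪ξ, w⟫_ℝ : ℂ) * (Complex.exp (-∑ j, b j * (w j : ℂ) ^ 2) * (𝓕 f) ξ)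
  have hc : Continuous fun p : EuclideanSpace ℝ ι × EuclideanSpace ℝ ι =>
      (Real.fourierChar ⟪p.2, p.1⟫_ℝ : ℂ) := by
    simp only [Real.fourierChar_apply]
    fun_prop
  have hint : Integrable (Function.uncurry F) (volume.prod volume) :=
    (hG.mul_prod (𝓕 f).integrable).bdd_mul (c := 1) hc.aestronglyMeasurable
      (Filter.Eventually.of_forall fun p => (Circle.norm_coe _).le)
  have h1 : ∀ w, Complex.exp (-∑ j, b j * (w j : ℂ) ^ 2) * f w = ∫ ξ, F w ξ := fun w => by
    rw [hinv w, ← integral_const_mul]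
    exact integral_congr_ae (Filter.Eventually.of_forall fun ξ => mul_left_comm _ _ _)
  have h2 : ∀ ξ, ∫ w, F w ξ = (∏ j, (Real.pi / b j) ^ (1 / 2 : ℂ)) *
      (Complex.exp (-∑ j, Real.pi ^ 2 * (ξ j : ℂ) ^ 2 / b j) * (𝓕 f) ξ) := fun ξ => by
    rw [← mul_assoc, ← integral_gaussian_mul_character hb, ← integral_mul_const]
    refine integral_congr_ae (Filter.Eventually.of_forall fun w => ?_)
    simp only [F]
    ring
  simp only [h1]
  rw [integral_integral_swap hint, ← integral_const_mul]
  simp only [h2]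

/-- The Fresnel version of Parseval's formula, obtained by letting the real part of the width of
the Gaussian tend to zero. -/
theorem integral_quadratic_phase_mul_eq {s : ι → ℝ} (hs : ∀ j, s j ≠ 0)
    (f : SchwartzMap (EuclideanSpace ℝ ι) ℂ) :
    ∫ w, Complex.exp (Complex.I * ((∑ j, s j * w j ^ 2 : ℝ) : ℂ)) * f w
      = (∏ j, (Real.pi * Complex.I / s j) ^ (1 / 2 : ℂ)) *
        ∫ ξ, Complex.exp (Complex.I * ((-∑ j, Real.pi ^ 2 * ξ j ^ 2 / s j : ℝ) : ℂ)) * (𝓕 f) ξ := by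
  -- the regularized widths; for `ε = 0` these are the coefficients of the oscillating Gaussian
  set b : ℝ → ι → ℂ := fun ε j => ε - Complex.I * s j with hb
  have hb0 : ∀ j, b 0 j ≠ 0 := fun j h0 => by
    have := hs j
    simp [hb] at h0
    exact this h0
  have hbc : ∀ j, ContinuousAt (fun ε => b ε j) 0 := fun j => by
    simp only [hb]
    fun_prop
  have hbre : ∀ ε j, (b ε j).re = ε := fun ε j => by simp [hb]
  have hpi : (Real.pi : ℂ) ≠ 0 := by exact_mod_cast Real.pi_ne_zero
  have hb0' : ∀ j, (b 0 j)⁻¹ = Complex.I / s j := fun j => by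
    have h1 : (s j : ℂ) ≠ 0 := by exact_mod_cast hs j
    rw [inv_eq_iff_eq_inv, inv_div, hb]
    field_simp
    rw [Complex.ofReal_zero]
    linear_combination (-(s j : ℂ)) * Complex.I_mul_I
  have hpos : ∀ᶠ ε : ℝ in 𝓝[>] 0, 0 < ε := self_mem_nhdsWithin
  have hl : Filter.Tendsto (fun ε => ∫ w, Complex.exp (-∑ j, b ε j * (w j : ℂ) ^ 2) * f w) (𝓝[>] 0)
      (𝓝 (∫ w, Complex.exp (-∑ j, b 0 j * (w j : ℂ) ^ 2) * f w)) := by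
    refine tendsto_integral_filter_of_dominated_convergence (fun w => ‖f w‖) ?_ ?_
      f.integrable.norm ?_
    · refine Filter.Eventually.of_forall fun ε => Continuous.aestronglyMeasurable ?_
      have := f.continuous
      fun_prop
    · filter_upwards [hpos] with ε hε
      refine Filter.Eventually.of_forall fun w => ?_
      rw [norm_mul, Complex.norm_exp]
      refine mul_le_of_le_one_left (norm_nonneg _) (Real.exp_le_one_iff.2 ?_)
      rw [Complex.neg_re, Complex.re_sum, neg_nonpos]
      refine Finset.sum_nonneg fun j _ => ?_
      rw [← Complex.ofReal_pow, Complex.re_mul_ofReal, hbre]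
      positivity
    · refine Filter.Eventually.of_forall fun w => ?_
      refine (ContinuousAt.tendsto ?_).mono_left nhdsWithin_le_nhds
      refine ContinuousAt.mul (ContinuousAt.cexp (ContinuousAt.neg ?_)) continuousAt_const
      exact tendsto_finsetSum _ fun j _ => (hbc j).mul continuousAt_const
  have hr : Filter.Tendsto (fun ε => (∏ j, (Real.pi / b ε j) ^ (1 / 2 : ℂ)) *
        ∫ ξ, Complex.exp (-∑ j, Real.pi ^ 2 * (ξ j : ℂ) ^ 2 / b ε j) * (𝓕 f) ξ) (𝓝[>] 0)
      (𝓝 ((∏ j, (Real.pi / b 0 j) ^ (1 / 2 : ℂ)) *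
        ∫ ξ, Complex.exp (-∑ j, Real.pi ^ 2 * (ξ j : ℂ) ^ 2 / b 0 j) * (𝓕 f) ξ)) := by
    refine Filter.Tendsto.mul ?_ ?_
    -- the principal square root is continuous at `π / b 0 j = iπ / s j`, off the negative axis
    · refine (tendsto_finsetProd _ fun j _ => ?_).mono_left nhdsWithin_le_nhds
      refine ContinuousAt.cpow (continuousAt_const.div (hbc j) (hb0 j)) continuousAt_const ?_
      refine Complex.mem_slitPlane_iff.2 (Or.inr ?_)
      rw [div_eq_mul_inv, hb0', Complex.im_ofReal_mul, Complex.div_ofReal_im, Complex.I_im]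
      exact mul_ne_zero Real.pi_ne_zero (one_div_ne_zero (hs j))
    · refine tendsto_integral_filter_of_dominated_convergence (fun ξ => ‖(𝓕 f) ξ‖) ?_ ?_
        (𝓕 f).integrable.norm ?_
      · refine Filter.Eventually.of_forall fun ε => Continuous.aestronglyMeasurable ?_
        have := (𝓕 f).continuous
        fun_prop
      · filter_upwards [hpos] with ε hε
        refine Filter.Eventually.of_forall fun ξ => ?_
        rw [norm_mul, Complex.norm_exp]
        refine mul_le_of_le_one_left (norm_nonneg _) (Real.exp_le_one_iff.2 ?_)
        rw [Complex.neg_re, Complex.re_sum, neg_nonpos]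
        refine Finset.sum_nonneg fun j _ => ?_
        rw [div_eq_mul_inv, ← Complex.ofReal_pow, ← Complex.ofReal_pow, ← Complex.ofReal_mul,
          Complex.re_ofReal_mul, Complex.inv_re, hbre]
        have := Complex.normSq_nonneg (b ε j)
        positivity
      · refine Filter.Eventually.of_forall fun ξ => ?_
        refine (ContinuousAt.tendsto ?_).mono_left nhdsWithin_le_nhds
        refine ContinuousAt.mul (ContinuousAt.cexp (ContinuousAt.neg ?_)) continuousAt_const
        exact tendsto_finsetSum _ fun j _ => continuousAt_const.div (hbc j) (hb0 j)
  have heq : ∀ᶠ ε : ℝ in 𝓝[>] 0, ∫ w, Complex.exp (-∑ j, b ε j * (w j : ℂ) ^ 2) * f w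
      = (∏ j, (Real.pi / b ε j) ^ (1 / 2 : ℂ)) *
        ∫ ξ, Complex.exp (-∑ j, Real.pi ^ 2 * (ξ j : ℂ) ^ 2 / b ε j) * (𝓕 f) ξ := by
    filter_upwards [hpos] with ε hε
    exact integral_gaussian_mul_eq (fun j => by rw [hbre]; exact hε) f
  have hlim := tendsto_nhds_unique (hl.congr' heq) hr
  simp only [div_eq_mul_inv _ (b 0 _), hb0'] at hlim
  convert hlim using 1
  · refine integral_congr_ae (Filter.Eventually.of_forall fun w => ?_)
    simp only
    congr 2
    push_cast
    rw [Finset.mul_sum, ← Finset.sum_neg_distrib]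
    refine Finset.sum_congr rfl fun j _ => ?_
    simp only [hb, Complex.ofReal_zero]
    ring
  · congr 1
    · refine Finset.prod_congr rfl fun j _ => ?_
      rw [mul_div_assoc]
    · refine integral_congr_ae (Filter.Eventually.of_forall fun ξ => ?_)
      simp only
      congr 2
      push_cast
      rw [mul_neg, Finset.mul_sum]
      congr 1
      refine Finset.sum_congr rfl fun j _ => ?_
      ring

/-- Leading order asymptotics for a diagonal quadratic phase. After Parseval's formula the integrand
is `e^{iO(h)|ξ|²}` times the Fourier transform of `f`, and the exponential is `1 + O(h |ξ|²)`. -/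
theorem norm_integral_quadratic_phase_sub_le {lam : ι → ℝ} (hlam : ∀ j, lam j ≠ 0)
    (f : SchwartzMap (EuclideanSpace ℝ ι) ℂ) :
    ∃ C : ℝ, ∀ h : ℝ, 0 < h →
      ‖(∫ w, Complex.exp (Complex.I * (((∑ j, lam j * w j ^ 2) / 2 : ℝ) : ℂ) / (h : ℂ)) * f w)
        - (∏ j, ((2 * Real.pi * h / lam j : ℝ) * Complex.I) ^ (1 / 2 : ℂ)) * f 0‖
      ≤ C * h * ‖∏ j, ((2 * Real.pi * h / lam j : ℝ) * Complex.I) ^ (1 / 2 : ℂ)‖ := by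
  set M : ℝ := 2 * Real.pi ^ 2 * ∑ j, |lam j|⁻¹ with hM
  have hint2 : Integrable fun ξ => ‖ξ‖ ^ 2 * ‖(𝓕 f) ξ‖ := (𝓕 f).integrable_pow_mul volume 2
  have hf0 : f 0 = ∫ ξ, (𝓕 f) ξ := by
    have h1 : (𝓕⁻ (𝓕 f) : SchwartzMap (EuclideanSpace ℝ ι) ℂ) 0 = f 0 := by simp
    rw [← h1, SchwartzMap.fourierInv_coe, Real.fourierInv_eq]
    simp
  refine ⟨M * ∫ ξ, ‖ξ‖ ^ 2 * ‖(𝓕 f) ξ‖, fun h hh => ?_⟩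
  have hs : ∀ j, lam j / (2 * h) ≠ 0 := fun j => div_ne_zero (hlam j) (by positivity)
  have hP : ∏ j, ((Real.pi : ℂ) * Complex.I / ((lam j / (2 * h) : ℝ) : ℂ)) ^ (1 / 2 : ℂ)
      = ∏ j, ((2 * Real.pi * h / lam j : ℝ) * Complex.I) ^ (1 / 2 : ℂ) := by
    refine Finset.prod_congr rfl fun j _ => ?_
    congr 1
    have h1 : (lam j : ℂ) ≠ 0 := by exact_mod_cast hlam j
    have h2 : (h : ℂ) ≠ 0 := by exact_mod_cast hh.ne'
    push_cast
    field_simp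
  have hL : ∫ w, Complex.exp (Complex.I * (((∑ j, lam j * w j ^ 2) / 2 : ℝ) : ℂ) / (h : ℂ)) * f w
      = ∫ w, Complex.exp (Complex.I * ((∑ j, lam j / (2 * h) * w j ^ 2 : ℝ) : ℂ)) * f w := by
    refine integral_congr_ae (Filter.Eventually.of_forall fun w => ?_)
    simp only
    congr 2
    rw [mul_div_assoc, ← Complex.ofReal_div]
    congr 2
    rw [Finset.sum_div, Finset.sum_div]
    refine Finset.sum_congr rfl fun j _ => ?_
    field_simp
  rw [hL, integral_quadratic_phase_mul_eq hs f, hP, hf0, ← mul_sub, norm_mul, mul_comm _ ‖∏ j, _‖]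
  refine mul_le_mul_of_nonneg_left ?_ (norm_nonneg _)
  have hi1 : Integrable fun ξ => Complex.exp (Complex.I *
      ((-∑ j, Real.pi ^ 2 * ξ j ^ 2 / (lam j / (2 * h)) : ℝ) : ℂ)) * (𝓕 f) ξ := by
    refine (𝓕 f).integrable.bdd_mul (c := 1) (Continuous.aestronglyMeasurable (by fun_prop)) ?_
    exact Filter.Eventually.of_forall fun ξ => (norm_cexp_I_mul _).le
  rw [← integral_sub hi1 (𝓕 f).integrable]
  have hbd : ∀ ξ : EuclideanSpace ℝ ι, ‖Complex.exp (Complex.I *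
      ((-∑ j, Real.pi ^ 2 * ξ j ^ 2 / (lam j / (2 * h)) : ℝ) : ℂ)) * (𝓕 f) ξ - (𝓕 f) ξ‖
      ≤ M * h * (‖ξ‖ ^ 2 * ‖(𝓕 f) ξ‖) := fun ξ => by
    rw [← sub_one_mul, norm_mul, ← mul_assoc]
    refine mul_le_mul_of_nonneg_right ?_ (norm_nonneg _)
    refine (Real.norm_exp_I_mul_ofReal_sub_one_le).trans ?_
    rw [norm_neg, Real.norm_eq_abs]
    refine (Finset.abs_sum_le_sum_abs _ _).trans ?_
    rw [hM, Finset.mul_sum, Finset.sum_mul, Finset.sum_mul]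
    refine Finset.sum_le_sum fun j _ => ?_
    have hξ : ξ j ^ 2 ≤ ‖ξ‖ ^ 2 := by
      have := PiLp.norm_apply_le ξ j
      rw [← sq_abs, ← Real.norm_eq_abs]
      gcongr
    have h2 : |Real.pi ^ 2 * ξ j ^ 2 / (lam j / (2 * h))|
        = 2 * Real.pi ^ 2 * |lam j|⁻¹ * h * ξ j ^ 2 := by
      rw [abs_div, abs_div, abs_of_nonneg (by positivity : 0 ≤ Real.pi ^ 2 * ξ j ^ 2),
        abs_of_pos (by positivity : 0 < 2 * h)]
      have := abs_pos.2 (hlam j)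
      field_simp
    rw [h2]
    gcongr
  calc _ ≤ ∫ ξ, M * h * (‖ξ‖ ^ 2 * ‖(𝓕 f) ξ‖) :=
        norm_integral_le_of_norm_le (hint2.const_mul _) (Filter.Eventually.of_forall hbd)
    _ = _ := by
        rw [integral_const_mul]
        ring

end QuadraticPhase

/-! ### Signature and determinant -/

section MatrixPhase

variable {ι : Type*} [Fintype ι] [DecidableEq ι]

theorem matrixSignature_eq_sum_sign {M : Matrix ι ι ℝ} (hM : M.IsHermitian) :
    matrixSignature M = ∑ j, (SignType.sign (hM.eigenvalues j) : ℤ) := by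
  have h : ∀ p : ℝ → Prop, ∀ [DecidablePred p],
      (Multiset.card (M.charpoly.roots.filter p) : ℤ)
        = ∑ j, if p (hM.eigenvalues j) then 1 else 0 := by
    intro p _
    rw [hM.roots_charpoly_eq_eigenvalues, Multiset.filter_map, Multiset.card_map,
      Finset.sum_boole]
    rfl
  rw [matrixSignature, h, h, ← Finset.sum_sub_distrib]
  refine Finset.sum_congr rfl fun j _ => ?_
  rcases lt_trichotomy (hM.eigenvalues j) 0 with hj | hj | hj
  · simp [hj, hj.not_gt]
  · simp [hj]
  · simp [hj, hj.not_gt]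

theorem cpow_half_ofReal_mul_I {r : ℝ} (hr : r ≠ 0) :
    ((r : ℂ) * Complex.I) ^ (1 / 2 : ℂ)
      = Real.sqrt |r| * Complex.I ^ (((SignType.sign r : ℤ) : ℂ) / 2) := by
  have hI : Complex.I ≠ 0 := Complex.I_ne_zero
  have habs : (0 : ℝ) < |r| := abs_pos.2 hr
  have hsqrt : ((Real.sqrt |r| : ℝ) : ℂ) = Complex.exp ((Real.log |r| : ℝ) / 2) := by
    rw [Real.sqrt_eq_rpow, Real.rpow_def_of_pos habs]
    push_cast
    congr 1
    ring
  rcases hr.lt_or_gt with h | h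
  · have hs : (((SignType.sign r : SignType) : ℤ) : ℂ) = -1 := by simp [sign_neg h]
    have h1 : (r : ℂ) * Complex.I = ((|r| : ℝ) : ℂ) * (-Complex.I) := by
      rw [abs_of_neg h]; push_cast; ring
    rw [h1, Complex.cpow_def_of_ne_zero (by simp [hr]), Complex.log_ofReal_mul habs (by simp),
      hsqrt, Complex.cpow_def_of_ne_zero hI, ← Complex.exp_add, hs, Complex.log_neg_I,
      Complex.log_I]
    congr 1
    ring
  · have hs : (((SignType.sign r : SignType) : ℤ) : ℂ) = 1 := by simp [sign_pos h]
    have h1 : (r : ℂ) * Complex.I = ((|r| : ℝ) : ℂ) * Complex.I := by rw [abs_of_pos h]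
    rw [h1, Complex.cpow_def_of_ne_zero (by simp [hr]), Complex.log_ofReal_mul habs (by simp),
      hsqrt, Complex.cpow_def_of_ne_zero hI, ← Complex.exp_add, hs, Complex.log_I]
    congr 1
    ring

/-- The product of the one dimensional Fresnel factors, in terms of signature and determinant. -/
theorem prod_cpow_half_eigenvalues {M : Matrix ι ι ℝ} (hM : M.IsHermitian) (hdet : M.det ≠ 0)
    {h : ℝ} (hh : 0 < h) :
    ∏ j, ((2 * Real.pi * h / hM.eigenvalues j : ℝ) * Complex.I) ^ (1 / 2 : ℂ)
      = (Real.sqrt (2 * Real.pi * h) ^ Fintype.card ι : ℝ) *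
        (Complex.I ^ ((matrixSignature M : ℂ) / 2) / (Real.sqrt |M.det| : ℝ)) := by
  have hdp : M.det = ∏ j, hM.eigenvalues j := by simpa using hM.det_eq_prod_eigenvalues
  have hlam : ∀ j, hM.eigenvalues j ≠ 0 := fun j h0 => hdet (by
    rw [hdp]; exact Finset.prod_eq_zero (Finset.mem_univ j) h0)
  have h2 : (0 : ℝ) < 2 * Real.pi * h := by positivity
  have hI : Complex.I ^ ((matrixSignature M : ℂ) / 2)
      = ∏ j, Complex.I ^ (((SignType.sign (hM.eigenvalues j) : ℤ) : ℂ) / 2) := by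
    rw [matrixSignature_eq_sum_sign hM]
    simp only [Complex.cpow_def_of_ne_zero Complex.I_ne_zero]
    rw [← Complex.exp_sum, ← Finset.mul_sum, ← Finset.sum_div]
    push_cast
    rfl
  have hS : Real.sqrt |M.det| = ∏ j, Real.sqrt |hM.eigenvalues j| := by
    rw [hdp, Finset.abs_prod, Real.sqrt_prod _ fun j _ => abs_nonneg _]
  rw [hI, hS, Fintype.card, ← Finset.prod_const]
  push_cast
  rw [← Finset.prod_div_distrib, ← Finset.prod_mul_distrib]
  refine Finset.prod_congr rfl fun j _ => ?_
  have hsg : SignType.sign (2 * Real.pi * h / hM.eigenvalues j)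
      = SignType.sign (hM.eigenvalues j) := by
    rcases (hlam j).lt_or_gt with hj | hj
    · rw [sign_neg hj, sign_neg (div_neg_of_pos_of_neg h2 hj)]
    · rw [sign_pos hj, sign_pos (div_pos h2 hj)]
  have := cpow_half_ofReal_mul_I (div_ne_zero h2.ne' (hlam j))
  rw [hsg, abs_div, abs_of_pos h2, Real.sqrt_div h2.le] at this
  push_cast at this
  rw [this]
  ring

theorem dotProduct_mulVec_eq_sum_eigenvalues {M : Matrix ι ι ℝ} (hM : M.IsHermitian)
    (v : EuclideanSpace ℝ ι) :
    v.ofLp ⬝ᵥ M.mulVec v.ofLp = ∑ j, hM.eigenvalues j * (hM.eigenvectorBasis.repr v j) ^ 2 := by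
  set u := hM.eigenvectorBasis
  have h1 : M.mulVec v.ofLp = ∑ j, (u.repr v j * hM.eigenvalues j) • (u j).ofLp := by
    conv_lhs => rw [← u.sum_repr v]
    rw [WithLp.ofLp_sum, Matrix.mulVec_sum]
    refine Finset.sum_congr rfl fun j _ => ?_
    rw [WithLp.ofLp_smul, Matrix.mulVec_smul, hM.mulVec_eigenvectorBasis, smul_smul]
  rw [h1, dotProduct_sum]
  refine Finset.sum_congr rfl fun j _ => ?_
  have h2 : v.ofLp ⬝ᵥ (u j).ofLp = u.repr v j := by
    rw [u.repr_apply_apply, EuclideanSpace.inner_eq_star_dotProduct]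
    simp
  rw [dotProduct_smul, h2, smul_eq_mul]
  ring

/-- Stationary phase for a nondegenerate quadratic phase, to leading order, by diagonalization in
an orthonormal basis of eigenvectors. -/
theorem norm_integral_matrix_phase_sub_le {M : Matrix ι ι ℝ} (hM : M.IsHermitian)
    (hdet : M.det ≠ 0) {f : EuclideanSpace ℝ ι → ℂ} (hf : ContDiff ℝ ∞ f)
    (hfc : HasCompactSupport f) :
    ∃ C : ℝ, ∀ h : ℝ, 0 < h →
      ‖(∫ v, Complex.exp (Complex.I * ((v.ofLp ⬝ᵥ M.mulVec v.ofLp / 2 : ℝ) : ℂ) / (h : ℂ)) * f v)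
        - (Real.sqrt (2 * Real.pi * h) ^ Fintype.card ι : ℝ) *
          (Complex.I ^ ((matrixSignature M : ℂ) / 2) / (Real.sqrt |M.det| : ℝ)) * f 0‖
      ≤ C * h * Real.sqrt (2 * Real.pi * h) ^ Fintype.card ι := by
  have hdp : M.det = ∏ j, hM.eigenvalues j := by simpa using hM.det_eq_prod_eigenvalues
  have hlam : ∀ j, hM.eigenvalues j ≠ 0 := fun j h0 => hdet (by
    rw [hdp]; exact Finset.prod_eq_zero (Finset.mem_univ j) h0)
  set u := hM.eigenvectorBasis
  let g : SchwartzMap (EuclideanSpace ℝ ι) ℂ :=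
    (hfc.comp_homeomorph u.repr.symm.toHomeomorph).toSchwartzMap
      (hf.comp u.repr.symm.contDiff)
  have hg : ∀ w, g w = f (u.repr.symm w) := fun _ => rfl
  obtain ⟨C, hC⟩ := norm_integral_quadratic_phase_sub_le hlam g
  refine ⟨C * ‖Complex.I ^ ((matrixSignature M : ℂ) / 2) / (Real.sqrt |M.det| : ℝ)‖, fun h hh => ?_⟩
  have hCh := hC h hh
  rw [prod_cpow_half_eigenvalues hM hdet hh, hg, map_zero, norm_mul, Complex.norm_real,
    Real.norm_of_nonneg (by positivity)] at hCh
  have hint : (∫ v, Complex.exp (Complex.I * ((v.ofLp ⬝ᵥ M.mulVec v.ofLp / 2 : ℝ) : ℂ) / (h : ℂ))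
        * f v) = ∫ w, Complex.exp (Complex.I *
          (((∑ j, hM.eigenvalues j * w j ^ 2) / 2 : ℝ) : ℂ) / (h : ℂ)) * g w := by
    refine Eq.trans ?_ (u.measurePreserving_repr.integral_comp
      u.repr.toHomeomorph.measurableEmbedding _)
    refine integral_congr_ae (Filter.Eventually.of_forall fun v => ?_)
    simp only [hg, dotProduct_mulVec_eq_sum_eigenvalues hM v, LinearIsometryEquiv.symm_apply_apply, u]
  rw [hint]
  refine hCh.trans_eq ?_
  ring

end MatrixPhase

/-! ### Stationary phase on phase space -/

section PhaseSpaceStationaryPhase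

variable {n : ℕ}

/-- The coordinate basis of phase space, `∂/∂xᵢ` followed by `∂/∂ηᵢ`. -/
noncomputable def phaseBasis (n : ℕ) : Module.Basis (Fin n ⊕ Fin n) ℝ (Phase n) :=
  (EuclideanSpace.basisFun (Fin n) ℝ).toBasis.prod (EuclideanSpace.basisFun (Fin n) ℝ).toBasis

@[simp]
theorem phaseBasis_inl (i : Fin n) : phaseBasis n (Sum.inl i) = vecX i := by
  simp [phaseBasis, vecX]

@[simp]
theorem phaseBasis_inr (i : Fin n) : phaseBasis n (Sum.inr i) = vecEta i := by
  simp [phaseBasis, vecEta]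

@[simp]
theorem phaseBasis_repr_inl (p : Phase n) (i : Fin n) :
    (phaseBasis n).repr p (Sum.inl i) = p.1 i := by
  simp [phaseBasis]

@[simp]
theorem phaseBasis_repr_inr (p : Phase n) (i : Fin n) :
    (phaseBasis n).repr p (Sum.inr i) = p.2 i := by
  simp [phaseBasis]

theorem phaseEquiv_eq_sum (v : EuclideanSpace ℝ (Fin n ⊕ Fin n)) :
    phaseEquiv n v = ∑ i, v i • phaseBasis n i := by
  have h : ∀ i, (phaseBasis n).repr (phaseEquiv n v) i = v i := by
    rintro (i | i) <;> simp
  simp only [← h, Module.Basis.sum_repr]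

variable {Ω : Set (Phase n)} {φ : Phase n → ℝ}

theorem hasFDerivAt_fderiv_of_contDiffOn (hΩ : IsOpen Ω) (hφ : ContDiffOn ℝ ∞ φ Ω) {p : Phase n}
    (hp : p ∈ Ω) : HasFDerivAt (fderiv ℝ φ) (fderiv ℝ (fderiv ℝ φ) p) p :=
  (((hφ.fderiv_of_isOpen hΩ (m := ∞) (by simp)).contDiffAt (hΩ.mem_nhds hp)).differentiableAt
    (by simp)).hasFDerivAt

theorem secondDeriv_eq (hΩ : IsOpen Ω) (hφ : ContDiffOn ℝ ∞ φ Ω) {p : Phase n}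
    (hp : p ∈ Ω) (v w : Phase n) : secondDeriv φ p v w = fderiv ℝ (fderiv ℝ φ) p v w := by
  have h := (hasFDerivAt_fderiv_of_contDiffOn hΩ hφ hp).clm_apply (hasFDerivAt_const w p)
  rw [secondDeriv, h.fderiv]
  simp

theorem secondDeriv_comm (hΩ : IsOpen Ω) (hφ : ContDiffOn ℝ ∞ φ Ω) {p : Phase n}
    (hp : p ∈ Ω) (v w : Phase n) : secondDeriv φ p v w = secondDeriv φ p w v := by
  rw [secondDeriv_eq hΩ hφ hp, secondDeriv_eq hΩ hφ hp]
  exact ((contDiffOn_infty.1 hφ 2).contDiffAt (hΩ.mem_nhds hp)).isSymmSndFDerivAt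
    (n := 2) (by simp) v w

/-- **Stationary phase** on phase space, to leading order: a single nondegenerate critical point
at the origin. The Hessian `M` is a `2n × 2n` matrix, whence the power `(2πh)^n`. -/
theorem norm_integral_phase_sub_le (hΩ : IsOpen Ω) (h0Ω : 0 ∈ Ω) (hφ : ContDiffOn ℝ ∞ φ Ω)
    (h1 : fderiv ℝ φ 0 = 0) (hcrit : ∀ p ∈ Ω, fderiv ℝ φ p = 0 → p = 0)
    {M : Matrix (Fin n ⊕ Fin n) (Fin n ⊕ Fin n) ℝ}
    (hM : ∀ i j, M i j = secondDeriv φ 0 (phaseBasis n i) (phaseBasis n j)) (hdet : M.det ≠ 0)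
    {a : Phase n → ℂ} (ha : ContDiff ℝ ∞ a) (hac : HasCompactSupport a) (hsupp : tsupport a ⊆ Ω) :
    ∃ C : ℝ, ∀ h : ℝ, 0 < h → ‖(∫ p, Complex.exp (Complex.I * (φ p : ℂ) / (h : ℂ)) * a p)
        - ((2 * Real.pi * h : ℝ) : ℂ) ^ n *
          (Complex.I ^ ((matrixSignature M : ℂ) / 2) / (Real.sqrt |M.det| : ℝ) *
            (a 0 * Complex.exp (Complex.I * (φ 0 : ℂ) / (h : ℂ))))‖ ≤ C * h ^ (n + 1) := by
  have hMH : ∀ i j, M i j = fderiv ℝ (fderiv ℝ φ) 0 (phaseBasis n i) (phaseBasis n j) :=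
    fun i j => by rw [hM, secondDeriv_eq hΩ hφ h0Ω]
  have hMherm : M.IsHermitian := by
    ext i j
    rw [Matrix.conjTranspose_apply, star_trivial, hM, hM, secondDeriv_comm hΩ hφ h0Ω]
  have hquad : ∀ v w : EuclideanSpace ℝ (Fin n ⊕ Fin n),
      fderiv ℝ (fderiv ℝ φ) 0 (phaseEquiv n v) (phaseEquiv n w) = v.ofLp ⬝ᵥ M.mulVec w.ofLp := by
    intro v w
    rw [phaseEquiv_eq_sum, phaseEquiv_eq_sum]
    simp only [map_sum, map_smul, sum_apply, smul_apply, smul_eq_mul, dotProduct, Matrix.mulVec,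
      ← hMH, Finset.mul_sum]
    rw [Finset.sum_comm]
    refine Finset.sum_congr rfl fun i _ => Finset.sum_congr rfl fun j _ => ?_
    ring
  have hinj : Function.Injective (fderiv ℝ (fderiv ℝ φ) 0 : Phase n →ₗ[ℝ] (Phase n →L[ℝ] ℝ)) := by
    rw [injective_iff_map_eq_zero]
    intro p hp
    obtain ⟨v, rfl⟩ := (phaseEquiv n).surjective p
    have hv : Matrix.vecMul v.ofLp M = 0 := by
      funext i
      have h2 := hquad v (EuclideanSpace.single i 1)
      have h3 : fderiv ℝ (fderiv ℝ φ) 0 (phaseEquiv n v) = 0 := hp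
      rw [h3, Matrix.dotProduct_mulVec] at h2
      simpa using h2.symm
    have hv0 := Matrix.eq_zero_of_vecMul_eq_zero hdet hv
    have : v = 0 := by
      ext i
      exact congrFun hv0 i
    rw [this, map_zero]
  have hfin : Module.finrank ℝ (Phase n) = Module.finrank ℝ (Phase n →L[ℝ] ℝ) := by
    rw [← (LinearMap.toContinuousLinearMap (𝕜 := ℝ) (E := Phase n) (F' := ℝ)).finrank_eq]
    exact Subspace.dual_finrank_eq.symm
  let Λ : Phase n ≃L[ℝ] (Phase n →L[ℝ] ℝ) :=
    (LinearMap.linearEquivOfInjective _ hinj hfin).toContinuousLinearEquiv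
  have hΛ : (Λ : Phase n →L[ℝ] (Phase n →L[ℝ] ℝ)) = fderiv ℝ (fderiv ℝ φ) 0 :=
    ContinuousLinearMap.ext fun v => rfl
  have : (volume : Measure (Phase n)).IsAddHaarMeasure := by
    rw [Measure.volume_eq_prod]
    infer_instance
  obtain ⟨f, C₁, hf, hfc, hf0, hC₁⟩ := exists_integral_sub_quadratic_le volume hΩ h0Ω hφ h1 hcrit
    Λ hΛ ha hac hsupp (n + 1)
  obtain ⟨C₂, hC₂⟩ := norm_integral_matrix_phase_sub_le hMherm hdet
    (hf.comp (phaseEquiv n).contDiff) (hfc.comp_homeomorph (phaseEquiv n).toHomeomorph)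
  refine ⟨C₁ + C₂ * (2 * Real.pi) ^ n, fun h hh => ?_⟩
  have hpow : Real.sqrt (2 * Real.pi * h) ^ Fintype.card (Fin n ⊕ Fin n) = (2 * Real.pi * h) ^ n := by
    rw [Fintype.card_sum, Fintype.card_fin, ← two_mul, pow_mul, Real.sq_sqrt (by positivity)]
  have hint : (∫ v, Complex.exp (Complex.I * ((v.ofLp ⬝ᵥ M.mulVec v.ofLp / 2 : ℝ) : ℂ) / (h : ℂ))
      * (f ∘ phaseEquiv n) v)
      = ∫ w, Complex.exp (Complex.I * ((Λ w w / 2 : ℝ) : ℂ) / (h : ℂ)) * f w := by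
    rw [← integral_comp_phaseEquiv (fun w => Complex.exp (Complex.I * ((Λ w w / 2 : ℝ) : ℂ) / (h : ℂ))
      * f w)]
    refine integral_congr_ae (Filter.Eventually.of_forall fun v => ?_)
    simp only [← hquad, ← hΛ]
    rfl
  have h2 := hC₂ h hh
  rw [hpow, hint, Function.comp_apply, map_zero, hf0] at h2
  set Q := ∫ w, Complex.exp (Complex.I * ((Λ w w / 2 : ℝ) : ℂ) / (h : ℂ)) * f w
  set ex := Complex.exp (Complex.I * (φ 0 : ℂ) / (h : ℂ))
  set I₀ := ∫ p, Complex.exp (Complex.I * (φ p : ℂ) / (h : ℂ)) * a p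
  set c := Complex.I ^ ((matrixSignature M : ℂ) / 2) / ((Real.sqrt |M.det| : ℝ) : ℂ)
  calc ‖I₀ - ((2 * Real.pi * h : ℝ) : ℂ) ^ n * (c * (a 0 * ex))‖
      = ‖(I₀ - ex * Q) + ex * (Q - ((2 * Real.pi * h) ^ n : ℝ) * c * a 0)‖ := by
        congr 1
        push_cast
        ring
    _ ≤ C₁ * h ^ (n + 1) + C₂ * h * (2 * Real.pi * h) ^ n := by
        refine (norm_add_le _ _).trans (add_le_add (hC₁ h hh) ?_)
        rw [norm_mul, norm_cexp_I_mul_div, one_mul]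
        exact h2
    _ = (C₁ + C₂ * (2 * Real.pi) ^ n) * h ^ (n + 1) := by ring

end PhaseSpaceStationaryPhase

/-! ### The canonical map and the Hessian -/

section CanonicalMap

variable {n : ℕ} {Ω : Set (Phase n)} {φ : Phase n → ℝ}

/-- The linear map sending the differential of a function on phase space to its gradient in `x`. -/
noncomputable def gradXMap (n : ℕ) : (Phase n →L[ℝ] ℝ) →L[ℝ] Conf n :=
  LinearMap.toContinuousLinearMap
    { toFun := fun l => (InnerProductSpace.toDual ℝ (Conf n)).symm
        (l.comp (ContinuousLinearMap.inl ℝ (Conf n) (Conf n)))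
      map_add' := fun l m => by rw [ContinuousLinearMap.add_comp, map_add]
      map_smul' := fun c l => by
        rw [ContinuousLinearMap.smul_comp, map_smulₛₗ, conj_trivial, RingHom.id_apply] }

/-- The linear map sending the differential of a function on phase space to its gradient in `η`. -/
noncomputable def gradEtaMap (n : ℕ) : (Phase n →L[ℝ] ℝ) →L[ℝ] Conf n :=
  LinearMap.toContinuousLinearMap
    { toFun := fun l => (InnerProductSpace.toDual ℝ (Conf n)).symm
        (l.comp (ContinuousLinearMap.inr ℝ (Conf n) (Conf n)))
      map_add' := fun l m => by rw [ContinuousLinearMap.add_comp, map_add]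
      map_smul' := fun c l => by
        rw [ContinuousLinearMap.smul_comp, map_smulₛₗ, conj_trivial, RingHom.id_apply] }

theorem inner_gradXMap (l : Phase n →L[ℝ] ℝ) (v : Conf n) : ⟪gradXMap n l, v⟫_ℝ = l (v, 0) := by
  simp [gradXMap]

theorem inner_gradEtaMap (l : Phase n →L[ℝ] ℝ) (v : Conf n) :
    ⟪gradEtaMap n l, v⟫_ℝ = l (0, v) := by
  simp [gradEtaMap]

theorem gradXMap_apply (l : Phase n →L[ℝ] ℝ) (i : Fin n) : gradXMap n l i = l (vecX i) := by
  rw [vecX, ← inner_gradXMap, EuclideanSpace.inner_single_right]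
  simp

theorem gradEtaMap_apply (l : Phase n →L[ℝ] ℝ) (i : Fin n) : gradEtaMap n l i = l (vecEta i) := by
  rw [vecEta, ← inner_gradEtaMap, EuclideanSpace.inner_single_right]
  simp

theorem gradX_eq {p : Phase n} (hd : DifferentiableAt ℝ φ p) :
    gradX φ p = gradXMap n (fderiv ℝ φ p) := by
  have h : HasFDerivAt (fun x => φ (x, p.2)) ((fderiv ℝ φ p).comp
      (ContinuousLinearMap.inl ℝ (Conf n) (Conf n))) p.1 :=
    HasFDerivAt.comp p.1 (g := φ) (f := fun x => (x, p.2)) hd.hasFDerivAt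
      (hasFDerivAt_prodMk_left p.1 p.2)
  rw [gradX, gradient, h.fderiv]
  rfl

theorem gradEta_eq {p : Phase n} (hd : DifferentiableAt ℝ φ p) :
    gradEta φ p = gradEtaMap n (fderiv ℝ φ p) := by
  have h : HasFDerivAt (fun η => φ (p.1, η)) ((fderiv ℝ φ p).comp
      (ContinuousLinearMap.inr ℝ (Conf n) (Conf n))) p.2 :=
    HasFDerivAt.comp p.2 (g := φ) (f := fun η => (p.1, η)) hd.hasFDerivAt
      (hasFDerivAt_prodMk_right p.1 p.2)
  rw [gradEta, gradient, h.fderiv]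
  rfl

theorem abs_det_fromBlocks_zero_neg_one_one_zero :
    |(Matrix.fromBlocks 0 (-1) 1 0 : Matrix (Fin n ⊕ Fin n) (Fin n ⊕ Fin n) ℝ).det| = 1 := by
  set J : Matrix (Fin n ⊕ Fin n) (Fin n ⊕ Fin n) ℝ := Matrix.fromBlocks 0 (-1) 1 0
  have h : J * J.transpose = 1 := by
    rw [Matrix.fromBlocks_transpose, Matrix.fromBlocks_multiply]
    simp
  have h2 := congrArg Matrix.det h
  rw [Matrix.det_mul, Matrix.det_transpose, Matrix.det_one, ← sq] at h2
  rw [← sq_eq_sq₀ (abs_nonneg _) zero_le_one, sq_abs, h2, one_pow]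

/-- With `F(x,η) = (φ'_η, η)` and `G(x,η) = (x, φ'_x)` one has `κ ∘ F = G`, so that
`(dκ - 1) dF = dG - dF` at the origin. Here `dF` has determinant `det φ''_{ηx}`, and `dG - dF` is
the Hessian of `φ - x·η` multiplied from the left by a matrix of determinant `±1`. -/
theorem abs_det_traceHessian_eq (hΩ : IsOpen Ω) (h0Ω : 0 ∈ Ω) (hφ : ContDiffOn ℝ ∞ φ Ω)
    (h1 : fderiv ℝ φ 0 = 0) {κ : OpenPartialHomeomorph (Phase n) (Phase n)}
    (hκ : IsCanonicalMapOf κ φ Ω) :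
    |(traceHessian φ).det|
      = |(hessEtaX φ).det * (fderiv ℝ κ 0 - ContinuousLinearMap.id ℝ (Phase n)).det| := by
  have hd : ∀ p ∈ Ω, DifferentiableAt ℝ φ p := fun p hp =>
    (hφ.contDiffAt (hΩ.mem_nhds hp)).differentiableAt (by simp)
  have hH := hasFDerivAt_fderiv_of_contDiffOn hΩ hφ h0Ω
  set H := fderiv ℝ (fderiv ℝ φ) 0 with hHdef
  let F' : Phase n →L[ℝ] Phase n :=
    ((gradEtaMap n).comp H).prod (ContinuousLinearMap.snd ℝ (Conf n) (Conf n))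
  let G' : Phase n →L[ℝ] Phase n :=
    (ContinuousLinearMap.fst ℝ (Conf n) (Conf n)).prod ((gradXMap n).comp H)
  have hF : HasFDerivAt (fun p => ((gradEta φ p, p.2) : Phase n)) F' 0 := by
    refine HasFDerivAt.prodMk ?_ hasFDerivAt_snd
    refine ((gradEtaMap n).hasFDerivAt.comp 0 hH).congr_of_eventuallyEq ?_
    filter_upwards [hΩ.mem_nhds h0Ω] with p hp using gradEta_eq (hd p hp)
  have hG : HasFDerivAt (fun p => ((p.1, gradX φ p) : Phase n)) G' 0 := by
    refine HasFDerivAt.prodMk hasFDerivAt_fst ?_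
    refine ((gradXMap n).hasFDerivAt.comp 0 hH).congr_of_eventuallyEq ?_
    filter_upwards [hΩ.mem_nhds h0Ω] with p hp using gradX_eq (hd p hp)
  have hF0 : ((gradEta φ 0, (0 : Phase n).2) : Phase n) = 0 := by
    rw [gradEta_eq (hd 0 h0Ω), h1, map_zero]
    rfl
  have h0s : (0 : Phase n) ∈ κ.source := by
    rw [hκ.source_eq]
    exact ⟨0, h0Ω, hF0⟩
  have hκd : HasFDerivAt κ (fderiv ℝ κ 0) ((gradEta φ 0, (0 : Phase n).2) : Phase n) := by
    rw [hF0]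
    exact ((hκ.contDiffOn.contDiffAt (κ.open_source.mem_nhds h0s)).differentiableAt
      (by simp)).hasFDerivAt
  have hcomp : (fderiv ℝ κ 0).comp F' = G' := by
    refine (HasFDerivAt.comp (0 : Phase n) hκd hF).unique (hG.congr_of_eventuallyEq ?_)
    filter_upwards [hΩ.mem_nhds h0Ω] with p hp using hκ.map_eq p hp
  have hsub : (fderiv ℝ κ 0 - ContinuousLinearMap.id ℝ (Phase n)).comp F' = G' - F' := by
    rw [ContinuousLinearMap.sub_comp, hcomp, ContinuousLinearMap.id_comp]
  have hsec : ∀ v w, secondDeriv φ 0 v w = H v w := fun v w => secondDeriv_eq hΩ hφ h0Ω v w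
  have hsymm : ∀ v w, H v w = H w v := fun v w => by
    rw [← hsec, ← hsec, secondDeriv_comm hΩ hφ h0Ω]
  have hF'm : LinearMap.toMatrix (phaseBasis n) (phaseBasis n) (F' : Phase n →ₗ[ℝ] Phase n)
      = Matrix.fromBlocks (hessEtaX φ) (hessEtaEta φ) 0 1 := by
    ext i j
    rw [LinearMap.toMatrix_apply]
    rcases i with i | i <;> rcases j with j | j <;>
      simp [F', gradEtaMap_apply, hessEtaX, hessEtaEta, hsec, hsymm (vecX j), hsymm (vecEta j)] <;>
      simp [vecX, vecEta, Matrix.one_apply]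
  have hG'm : LinearMap.toMatrix (phaseBasis n) (phaseBasis n) (G' : Phase n →ₗ[ℝ] Phase n)
      = Matrix.fromBlocks 1 0 (hessXX φ) (hessXEta φ) := by
    ext i j
    rw [LinearMap.toMatrix_apply]
    rcases i with i | i <;> rcases j with j | j <;>
      simp [G', gradXMap_apply, hessXX, hessXEta, hsec, hsymm (vecX j), hsymm (vecEta j)] <;>
      simp [vecX, vecEta, Matrix.one_apply]
  have hFdet : F'.det = (hessEtaX φ).det := by
    rw [ContinuousLinearMap.det, ← LinearMap.det_toMatrix (phaseBasis n), hF'm,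
      Matrix.det_fromBlocks_zero₂₁, Matrix.det_one, mul_one]
  have hGFdet : |(G' - F').det| = |(traceHessian φ).det| := by
    have hm : LinearMap.toMatrix (phaseBasis n) (phaseBasis n) ((G' - F' : Phase n →L[ℝ] Phase n) :
        Phase n →ₗ[ℝ] Phase n) = Matrix.fromBlocks 0 (-1) 1 0 * traceHessian φ := by
      rw [ContinuousLinearMap.toLinearMap_sub, map_sub, hF'm, hG'm, traceHessian,
        Matrix.fromBlocks_multiply]
      ext i j
      rcases i with i | i <;> rcases j with j | j <;> simp
    rw [ContinuousLinearMap.det, ← LinearMap.det_toMatrix (phaseBasis n), hm, Matrix.det_mul,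
      abs_mul, abs_det_fromBlocks_zero_neg_one_one_zero, one_mul]
  rw [← hGFdet, ← hsub, ← hFdet, mul_comm]
  congr 1
  exact LinearMap.det_comp _ _

end CanonicalMap

/-! ### The phase of the trace and the asymptotics -/

section TraceAsymptotics

variable {n : ℕ} {Ω K : Set (Phase n)} {φ ψ : Phase n → ℝ} {b : ℝ → Phase n → ℂ}
  {bc : ℕ → Phase n → ℂ}

/-- The bilinear form `((x,η), (y,ξ)) ↦ x·ξ + η·y`, the Hessian of the function `x·η` on phase
space. -/
noncomputable def phasePairing (n : ℕ) : Phase n →L[ℝ] Phase n →L[ℝ] ℝ :=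
  (innerSL ℝ).bilinearComp (ContinuousLinearMap.fst ℝ (Conf n) (Conf n))
      (ContinuousLinearMap.snd ℝ (Conf n) (Conf n))
    + (innerSL ℝ).bilinearComp (ContinuousLinearMap.snd ℝ (Conf n) (Conf n))
      (ContinuousLinearMap.fst ℝ (Conf n) (Conf n))

theorem phasePairing_apply (p q : Phase n) :
    phasePairing n p q = ⟪p.1, q.2⟫_ℝ + ⟪p.2, q.1⟫_ℝ := by
  simp [phasePairing]

theorem hasFDerivAt_inner_fst_snd (p : Phase n) :
    HasFDerivAt (fun q : Phase n => ⟪q.1, q.2⟫_ℝ) (phasePairing n p) p := by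
  refine (HasFDerivAt.inner ℝ hasFDerivAt_fst hasFDerivAt_snd).congr_fderiv ?_
  ext q <;> simp [phasePairing_apply, real_inner_comm]

theorem contDiff_inner_fst_snd : ContDiff ℝ ∞ fun q : Phase n => ⟪q.1, q.2⟫_ℝ :=
  contDiff_fst.inner ℝ contDiff_snd

theorem fderiv_sub_inner {p : Phase n} (hd : DifferentiableAt ℝ φ p) :
    fderiv ℝ (fun q : Phase n => φ q - ⟪q.1, q.2⟫_ℝ) p = fderiv ℝ φ p - phasePairing n p :=
  (hd.hasFDerivAt.sub (hasFDerivAt_inner_fst_snd p)).fderiv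

/-- At a critical point of `φ(x,η) - x·η` one has `φ'_η = x` and `φ'_x = η`, so that `(x,η)` is a
fixed point of the canonical map. -/
theorem eq_zero_of_fderiv_sub_inner_eq_zero (hΩ : IsOpen Ω) (hφ : ContDiffOn ℝ ∞ φ Ω)
    {κ : OpenPartialHomeomorph (Phase n) (Phase n)} (hκ : IsCanonicalMapOf κ φ Ω)
    (hfix : ∀ ρ ∈ κ.source, κ ρ = ρ → ρ = 0) {p : Phase n} (hp : p ∈ Ω)
    (hcrit : fderiv ℝ (fun q : Phase n => φ q - ⟪q.1, q.2⟫_ℝ) p = 0) : p = 0 := by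
  have hd : DifferentiableAt ℝ φ p := (hφ.contDiffAt (hΩ.mem_nhds hp)).differentiableAt (by simp)
  rw [fderiv_sub_inner hd, sub_eq_zero] at hcrit
  have hX : gradX φ p = p.2 := by
    refine ext_inner_right ℝ fun v => ?_
    rw [gradX_eq hd, inner_gradXMap, hcrit, phasePairing_apply, inner_zero_right, zero_add]
  have hE : gradEta φ p = p.1 := by
    refine ext_inner_right ℝ fun v => ?_
    rw [gradEta_eq hd, inner_gradEtaMap, hcrit, phasePairing_apply, inner_zero_right, add_zero]
  have hmap := hκ.map_eq p hp
  have hmem : ((gradEta φ p, p.2) : Phase n) ∈ κ.source := by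
    rw [hκ.source_eq]
    exact ⟨p, hp, rfl⟩
  rw [hE] at hmap hmem
  rw [hX] at hmap
  exact hfix p hmem hmap

theorem traceHessian_apply_eq (hΩ : IsOpen Ω) (h0Ω : 0 ∈ Ω) (hφ : ContDiffOn ℝ ∞ φ Ω)
    (i j : Fin n ⊕ Fin n) : traceHessian φ i j
      = secondDeriv (fun q : Phase n => φ q - ⟪q.1, q.2⟫_ℝ) 0 (phaseBasis n i)
        (phaseBasis n j) := by
  have hd : HasFDerivAt (fderiv ℝ fun q : Phase n => φ q - ⟪q.1, q.2⟫_ℝ)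
      (fderiv ℝ (fderiv ℝ φ) 0 - phasePairing n) 0 := by
    refine ((hasFDerivAt_fderiv_of_contDiffOn hΩ hφ h0Ω).sub
      (phasePairing n).hasFDerivAt).congr_of_eventuallyEq ?_
    filter_upwards [hΩ.mem_nhds h0Ω] with p hp using
      fderiv_sub_inner ((hφ.contDiffAt (hΩ.mem_nhds hp)).differentiableAt (by simp))
  rw [secondDeriv_eq hΩ (hφ.sub contDiff_inner_fst_snd.contDiffOn) h0Ω, hd.fderiv,
    sub_apply, sub_apply, ← secondDeriv_eq hΩ hφ h0Ω, phasePairing_apply]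
  rcases i with i | i <;> rcases j with j | j <;>
    simp [traceHessian, hessXX, hessXEta, hessEtaX, hessEtaEta, vecX, vecEta, Matrix.one_apply,
      EuclideanSpace.inner_single_left, eq_comm]

/-- The coefficients of a classical symbol vanish off `K` like the symbol itself: successively, the
leading remaining coefficient at such a point is `O(h)`. -/
theorem IsClassicalSymbol.coeff_eq_zero (hb : IsClassicalSymbol b bc K) {p : Phase n}
    (hp : p ∉ K) (j : ℕ) : bc j p = 0 := by
  induction j using Nat.strong_induction_on with
  | _ j ih =>
    obtain ⟨C, hC⟩ := hb.expansion (j + 1) 0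
    have hle : ∀ h ∈ Ioc (0 : ℝ) 1, ‖bc j p‖ ≤ C * h := by
      intro h hh
      have h1 := hC h hh p
      have h2 : b h p = 0 :=
        image_eq_zero_of_notMem_tsupport fun hcon => hp (hb.tsupport_subset h hh hcon)
      rw [norm_iteratedFDeriv_zero, h2, Finset.sum_range_succ,
        Finset.sum_eq_zero fun i hi => by rw [ih i (Finset.mem_range.1 hi), mul_zero], zero_add,
        zero_sub, norm_neg, norm_mul, norm_pow, Complex.norm_real, Real.norm_of_nonneg hh.1.le,
        pow_succ', ← mul_assoc, mul_comm] at h1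
      exact le_of_mul_le_mul_right h1 (pow_pos hh.1 j)
    have hlim : Filter.Tendsto (fun h : ℝ => C * h) (𝓝[>] 0) (𝓝 0) := by
      have h3 : Filter.Tendsto (fun h : ℝ => C * h) (𝓝 0) (𝓝 (C * 0)) :=
        (continuous_const_mul C).tendsto 0
      rw [mul_zero] at h3
      exact h3.mono_left nhdsWithin_le_nhds
    refine norm_le_zero_iff.1 (ge_of_tendsto hlim ?_)
    filter_upwards [Ioc_mem_nhdsGT zero_lt_one] with h hh using hle h hh

theorem IsClassicalSymbol.tsupport_coeff_subset (hb : IsClassicalSymbol b bc K)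
    (hK : IsClosed K) (j : ℕ) : tsupport (bc j) ⊆ K :=
  closure_minimal (fun _ hp => by_contra fun hcon => hp (hb.coeff_eq_zero hcon j)) hK

/-- Stationary phase, to leading order, for an amplitude which is a classical symbol. The symbol is
expanded up to an error `O(h^{n+1})`, small enough to be estimated by its supremum, and stationary
phase is applied to each of the finitely many terms. -/
theorem norm_integral_symbol_sub_le (hΩ : IsOpen Ω) (h0Ω : 0 ∈ Ω) (hψ : ContDiffOn ℝ ∞ ψ Ω)
    (h1 : fderiv ℝ ψ 0 = 0) (hcrit : ∀ p ∈ Ω, fderiv ℝ ψ p = 0 → p = 0)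
    {M : Matrix (Fin n ⊕ Fin n) (Fin n ⊕ Fin n) ℝ}
    (hM : ∀ i j, M i j = secondDeriv ψ 0 (phaseBasis n i) (phaseBasis n j)) (hdet : M.det ≠ 0)
    (hK : IsCompact K) (hKΩ : K ⊆ Ω) (hb : IsClassicalSymbol b bc K) :
    ∃ C : ℝ, ∀ h ∈ Ioc (0 : ℝ) 1,
      ‖(∫ p, Complex.exp (Complex.I * (ψ p : ℂ) / (h : ℂ)) * b h p)
        - ((2 * Real.pi * h : ℝ) : ℂ) ^ n *
          (Complex.I ^ ((matrixSignature M : ℂ) / 2) / (Real.sqrt |M.det| : ℝ) *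
            (bc 0 0 * Complex.exp (Complex.I * (ψ 0 : ℂ) / (h : ℂ))))‖ ≤ C * h ^ (n + 1) := by
  have hts := hb.tsupport_coeff_subset hK.isClosed
  have hcs : ∀ j, HasCompactSupport (bc j) := fun j => hK.of_isClosed_subset
    (isClosed_tsupport _) (hts j)
  have hint : ∀ (h : ℝ) (a : Phase n → ℂ), ContDiff ℝ ∞ a → tsupport a ⊆ K →
      Integrable fun p => Complex.exp (Complex.I * (ψ p : ℂ) / (h : ℂ)) * a p := fun h a ha has =>
    ((contDiffOn_cexp_phase hψ h).contDiff_mul_of_tsupport_subset hΩ ha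
      (has.trans hKΩ)).continuous.integrable_of_hasCompactSupport
      (HasCompactSupport.mul_left (hK.of_isClosed_subset (isClosed_tsupport _) has))
  choose A hA using fun j => norm_integral_phase_sub_le hΩ h0Ω hψ h1 hcrit hM hdet
    (hb.contDiff_coeff j) (hcs j) ((hts j).trans hKΩ)
  obtain ⟨C, hC⟩ := hb.expansion (n + 1) 0
  set c := Complex.I ^ ((matrixSignature M : ℂ) / 2) / ((Real.sqrt |M.det| : ℝ) : ℂ)
  refine ⟨A 0 + ∑ j ∈ Finset.range n, (|A (j + 1)| + (2 * Real.pi) ^ n * (‖c‖ * ‖bc (j + 1) 0‖))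
    + C * volume.real K, fun h hh => ?_⟩
  have hpos := hh.1
  set e : Phase n → ℂ := fun p => Complex.exp (Complex.I * (ψ p : ℂ) / (h : ℂ)) with he
  have hen : ∀ p, ‖e p‖ = 1 := fun p => norm_cexp_I_mul_div _ _
  set R : Phase n → ℂ := fun q => b h q - ∑ j ∈ Finset.range (n + 1), (h : ℂ) ^ j * bc j q with hR
  have hRK : ∀ p, p ∉ K → R p = 0 := by
    intro p hp
    have h2 : b h p = 0 :=
      image_eq_zero_of_notMem_tsupport fun hcon => hp (hb.tsupport_subset h hh hcon)
    simp [hR, h2, hb.coeff_eq_zero hp]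
  have hRC : ∀ p, ‖R p‖ ≤ C * h ^ (n + 1) := fun p => by
    simpa only [norm_iteratedFDeriv_zero] using hC h hh p
  have hRint : ‖∫ p, e p * R p‖ ≤ C * volume.real K * h ^ (n + 1) := by
    rw [← setIntegral_eq_integral_of_forall_compl_eq_zero (s := K)
      fun p hp => by rw [hRK p hp, mul_zero]]
    refine (norm_setIntegral_le_of_norm_le_const hK.measure_lt_top
      (C := C * h ^ (n + 1)) fun p _ => ?_).trans_eq (by ring)
    rw [norm_mul, hen, one_mul]
    exact hRC p
  have hsplit : ∫ p, e p * b h p = (∫ p, e p * bc 0 p)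
      + ∑ j ∈ Finset.range n, (h : ℂ) ^ (j + 1) * (∫ p, e p * bc (j + 1) p)
      + ∫ p, e p * R p := by
    have hi : ∀ j, Integrable fun p => (h : ℂ) ^ j * (e p * bc j p) := fun j =>
      (hint h _ (hb.contDiff_coeff j) (hts j)).const_mul _
    have h3 : ∫ p, e p * R p = (∫ p, e p * b h p)
        - ∑ j ∈ Finset.range (n + 1), ∫ p, (h : ℂ) ^ j * (e p * bc j p) := by
      rw [← integral_finsetSum _ fun j _ => hi j, ← integral_sub
        (hint h _ (hb.contDiff h hh) (hb.tsupport_subset h hh))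
        (integrable_finsetSum _ fun j _ => hi j)]
      refine integral_congr_ae (Filter.Eventually.of_forall fun p => ?_)
      simp only [hR, mul_sub, Finset.mul_sum]
      congr 1
      exact Finset.sum_congr rfl fun j _ => by ring
    rw [h3, Finset.sum_range_succ']
    simp only [integral_const_mul]
    rw [pow_zero, one_mul]
    ring
  have hterm : ∀ j, ‖(h : ℂ) ^ (j + 1) * ∫ p, e p * bc (j + 1) p‖
      ≤ (|A (j + 1)| + (2 * Real.pi) ^ n * (‖c‖ * ‖bc (j + 1) 0‖)) * h ^ (n + 1) := by
    intro j
    have h4 : ‖∫ p, e p * bc (j + 1) p‖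
        ≤ (|A (j + 1)| + (2 * Real.pi) ^ n * (‖c‖ * ‖bc (j + 1) 0‖)) * h ^ n := by
      have h5 := norm_le_norm_add_norm_sub' (∫ p, e p * bc (j + 1) p)
        (((2 * Real.pi * h : ℝ) : ℂ) ^ n * (c * (bc (j + 1) 0 * e 0)))
      have h6 : A (j + 1) * h ^ (n + 1) ≤ |A (j + 1)| * h ^ n :=
        mul_le_mul (le_abs_self _) (pow_le_pow_of_le_one hpos.le hh.2 n.le_succ) (by positivity)
          (abs_nonneg _)
      have h7 : ‖((2 * Real.pi * h : ℝ) : ℂ) ^ n * (c * (bc (j + 1) 0 * e 0))‖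
          = (2 * Real.pi) ^ n * (‖c‖ * ‖bc (j + 1) 0‖) * h ^ n := by
        rw [norm_mul, norm_mul, norm_mul, hen, norm_pow, Complex.norm_real,
          Real.norm_of_nonneg (by positivity)]
        ring
      linarith [hA (j + 1) h hpos]
    rw [norm_mul, norm_pow, Complex.norm_real, Real.norm_of_nonneg hpos.le]
    have h8 : h ^ (j + 1) ≤ h := pow_le_of_le_one hpos.le hh.2 j.succ_ne_zero
    calc h ^ (j + 1) * ‖∫ p, e p * bc (j + 1) p‖
        ≤ h * ((|A (j + 1)| + (2 * Real.pi) ^ n * (‖c‖ * ‖bc (j + 1) 0‖)) * h ^ n) := by gcongr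
      _ = _ := by ring
  calc ‖(∫ p, e p * b h p) - ((2 * Real.pi * h : ℝ) : ℂ) ^ n * (c * (bc 0 0 * e 0))‖
      = ‖((∫ p, e p * bc 0 p) - ((2 * Real.pi * h : ℝ) : ℂ) ^ n * (c * (bc 0 0 * e 0)))
        + ∑ j ∈ Finset.range n, (h : ℂ) ^ (j + 1) * (∫ p, e p * bc (j + 1) p)
        + ∫ p, e p * R p‖ := by
        rw [hsplit]
        congr 1
        ring
    _ ≤ A 0 * h ^ (n + 1) + ∑ j ∈ Finset.range n,
          (|A (j + 1)| + (2 * Real.pi) ^ n * (‖c‖ * ‖bc (j + 1) 0‖)) * h ^ (n + 1)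
        + C * volume.real K * h ^ (n + 1) :=
        norm_add₃_le.trans (add_le_add (add_le_add (hA 0 h hpos)
          (norm_sum_le_of_le _ fun j _ => hterm j)) hRint)
    _ = _ := by rw [← Finset.sum_mul]; ring

end TraceAsymptotics

theorem lemma6p1 (n : ℕ) (φ : Phase n → ℝ) (Ω : Set (Phase n))
    (hΩ : IsOpen Ω) (hΩ0 : (0 : Phase n) ∈ Ω)
    (hφ : ContDiffOn ℝ ∞ φ Ω)
    (hφ0 : fderiv ℝ φ 0 = 0)
    (hdet : (hessXEta φ).det ≠ 0)
    (κ : OpenPartialHomeomorph (Phase n) (Phase n))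
    (hκ : IsCanonicalMapOf κ φ Ω)
    (hfix : ∀ ρ ∈ κ.source, κ ρ = ρ → ρ = 0)
    (hnd : (fderiv ℝ κ 0 - ContinuousLinearMap.id ℝ (Phase n)).det ≠ 0)
    (K : Set (Phase n)) (hK : IsCompact K) (hKΩ : K ⊆ Ω)
    (b : ℝ → Phase n → ℂ) (bc : ℕ → Phase n → ℂ) (hb : IsClassicalSymbol b bc K) :
    (∀ h ∈ Ioc (0 : ℝ) 1, ∃! B : L2 n →L[ℂ] L2 n, IsOscIntOperator φ (b h) h B) ∧
    ∃ (r : ℝ → ℂ) (C : ℝ), ∀ h ∈ Ioc (0 : ℝ) 1, ‖r h‖ ≤ C * h ∧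
      ∀ B : L2 n →L[ℂ] L2 n, IsOscIntOperator φ (b h) h B →
        HasTrace B
          (Complex.I ^ ((matrixSignature (traceHessian φ) : ℂ) / 2)
            * ((bc 0 0 + r h) * Complex.exp (Complex.I * (φ 0 : ℂ) / (h : ℂ)))
            / ((Real.sqrt |(hessEtaX φ).det
                * (fderiv ℝ κ 0 - ContinuousLinearMap.id ℝ (Phase n)).det| : ℝ) : ℂ)) := by
  have hop := fun h (hh : h ∈ Ioc (0 : ℝ) 1) => existsUnique_and_hasTrace hh.1
    ((contDiffOn_cexp_phase hφ h).contDiff_mul_of_tsupport_subset hΩ (hb.contDiff h hh)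
      ((hb.tsupport_subset h hh).trans hKΩ))
    (hK.of_isClosed_subset (isClosed_tsupport _) (hb.tsupport_subset h hh))
  refine ⟨fun h hh => (hop h hh).1, ?_⟩
  have hEX : (hessEtaX φ).det = (hessXEta φ).det := by
    rw [← Matrix.det_transpose (hessXEta φ)]
    congr 1
    ext i j
    exact secondDeriv_comm hΩ hφ hΩ0 _ _
  have habs := abs_det_traceHessian_eq hΩ hΩ0 hφ hφ0 hκ
  rw [← habs]
  have hTdet : (traceHessian φ).det ≠ 0 := by
    rw [← abs_pos, habs, abs_pos, hEX]
    exact mul_ne_zero hdet hnd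
  have hd0 : DifferentiableAt ℝ φ 0 :=
    (hφ.contDiffAt (hΩ.mem_nhds hΩ0)).differentiableAt (by simp)
  obtain ⟨C, hC⟩ := norm_integral_symbol_sub_le hΩ hΩ0
    (hφ.sub contDiff_inner_fst_snd.contDiffOn)
    (by rw [fderiv_sub_inner hd0, hφ0, map_zero, sub_zero])
    (fun p hp => eq_zero_of_fderiv_sub_inner_eq_zero hΩ hφ hκ hfix hp)
    (traceHessian_apply_eq hΩ hΩ0 hφ) hTdet hK hKΩ hb
  have hS : ((Real.sqrt |(traceHessian φ).det| : ℝ) : ℂ) ≠ 0 :=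
    Complex.ofReal_ne_zero.2 (Real.sqrt_pos.2 (abs_pos.2 hTdet)).ne'
  have hI : Complex.I ^ ((matrixSignature (traceHessian φ) : ℂ) / 2) ≠ 0 := by
    simp [Complex.cpow_eq_zero_iff]
  set S := ((Real.sqrt |(traceHessian φ).det| : ℝ) : ℂ)
  set w := Complex.I ^ ((matrixSignature (traceHessian φ) : ℂ) / 2)
  have hc : 0 < ‖w / S‖ := norm_pos_iff.2 (div_ne_zero hI hS)
  -- the remainder is what is left of the exact trace after division by the leading factors
  let X : ℝ → ℂ := fun h => (1 / ((2 * Real.pi * h : ℝ) : ℂ) ^ n) * ∫ p : Phase n,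
    Complex.exp (Complex.I * ((φ p - ⟪p.1, p.2⟫_ℝ : ℝ) : ℂ) / (h : ℂ)) * b h p
  refine ⟨fun h => X h / (w / S * Complex.exp (Complex.I * (φ 0 : ℂ) / (h : ℂ))) - bc 0 0,
    C / ((2 * Real.pi) ^ n * ‖w / S‖), fun h hh => ⟨?_, fun B hB => ?_⟩⟩
  · have hpos := hh.1
    have h2 := hC h hh
    rw [Prod.fst_zero, inner_zero_left, sub_zero] at h2
    have hP : ((2 * Real.pi * h : ℝ) : ℂ) ^ n ≠ 0 :=
      pow_ne_zero _ (Complex.ofReal_ne_zero.2 (by positivity))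
    have hPn : ‖((2 * Real.pi * h : ℝ) : ℂ) ^ n‖ = (2 * Real.pi * h) ^ n := by
      rw [norm_pow, Complex.norm_real, Real.norm_of_nonneg (by positivity)]
    have hen := norm_cexp_I_mul_div (φ 0) h
    have he : Complex.exp (Complex.I * (φ 0 : ℂ) / (h : ℂ)) ≠ 0 := Complex.exp_ne_zero _
    simp only [X]
    set e := Complex.exp (Complex.I * (φ 0 : ℂ) / (h : ℂ))
    set J := ∫ p : Phase n,
      Complex.exp (Complex.I * ((φ p - ⟪p.1, p.2⟫_ℝ : ℝ) : ℂ) / (h : ℂ)) * b h p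
    set P := ((2 * Real.pi * h : ℝ) : ℂ) ^ n
    have hr : 1 / P * J / (w / S * e) - bc 0 0
        = (J - P * (w / S * (bc 0 0 * e))) / (P * (w / S) * e) := by
      field_simp
    rw [hr, norm_div, norm_mul, norm_mul, hPn, hen, mul_one, div_le_iff₀ (by positivity)]
    refine h2.trans_eq ?_
    field_simp
    ring
  · convert (hop h hh).2 B hB using 1
    have he : Complex.exp (Complex.I * (φ 0 : ℂ) / (h : ℂ)) ≠ 0 := Complex.exp_ne_zero _
    rw [add_sub_cancel, mul_comm, mul_div_assoc]
    change X h / _ * _ * (w / S) = X h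
    field_simp
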